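/- Let $n\ge1$ be an integer and let $s>-1$ be real. For real $p,q>0$ put $$c_{p,q}(s)=\frac12\left(\frac{\Gamma(n+p)\,\Gamma(n+q)}{\Gamma(n)\,\Gamma(n+p+q)}\right)^{2}\int_0^1 t^{p+q+n-1}\,{}_2F_1\!\left(p,q;\,p+q+n;\,t\right)^2(1-t)^s\,dt ,$$ where ${}_2F_1$ is the Gauss hypergeometric function. Then there are real numbers $a_j(p,q)$ ($j=0,1,2,\dots$; $p,q>0$), depending also on $n$ and $s$, with $a_0(p,q)=1$, such that for all fixed $p,q>0$, as $\lambda\to+\infty$ through real values, one has the asymptotic expansion $$c_{\lambda p,\lambda q}(s)\approx\frac12\cdot\frac{\Gamma(2n+s+1)\,\Gamma(n+s+1)^2\,\Gamma(s+1)}{\Gamma(n)^2\,\Gamma(2n+2s+2)}\cdot\frac{\lambda^{-2s-2}}{(pq)^{s+1}}\sum_{j=0}^\infty\frac{a_j(p,q)}{\lambda^j}.$$ That is, for every $N\in\{0,1,2,\dots\}$, the difference between $c_{\lambda p,\lambda q}(s)$ and the right-hand side with the sum restricted to $j<N$ is $O(\lambda^{-2s-2-N})$ as $\lambda\to+\infty$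 (the implied constant may depend on $n,s,p,q,N$). -/

import Mathlib

open Filter Asymptotics

/-- The coefficient
`c_{pq}(s) = ½ (Γ(n+p) Γ(n+q) / (Γ(n) Γ(n+p+q)))²
  ∫₀¹ t^(p+q+n-1) ₂F₁(p, q; p+q+n; t)² (1-t)^s dt`
of the weighted `M`-harmonic Bergman kernel on the unit ball of `ℂⁿ` (real `p`, `q`, `s`). -/
noncomputable def weightedCoeff (n : ℕ) (s p q : ℝ) : ℝ :=
  1 / 2 * (Real.Gamma (n + p) * Real.Gamma (n + q)
      / (Real.Gamma n * Real.Gamma (n + p + q))) ^ 2 *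
    ∫ t in (0 : ℝ)..1,
      t ^ (p + q + n - 1) * (ordinaryHypergeometric p q (p + q + n) t) ^ 2 * (1 - t) ^ s

open MeasureTheory Set
open scoped Topology

/-! Put `ε = 1/λ`. Euler's integral turns the hypergeometric function, together with its Gamma
quotient, into an integral over `w > 0` (`ordinaryHypergeometric_eq_integral`). Substituting `w = ε
y / q` and `1 - t = ε² τ / (p q)`, and squaring, produces two variables `y₁, y₂`; the coefficient is
then exactly `½ Γ(n)⁻² (ε² / (p q))^(s+1)` times the integral over the octant of `τ^s (y₁ y₂)^(n-1)
B_ε` (`weightedCoeff_eq_integral_octant`). As `ε → 0`, `B_ε` tends to `exp(-U)` with `U = y₁ + y₂ +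
τ/y₁ + τ/y₂`.

Where `ε (1 + U)² ≤ 1`, the product `B_ε exp U` has an expansion in powers of `ε` whose coefficients
and remainder grow polynomially in `U` (`hasUniformExpansion_rescaledIntegrand`), and `exp(-U)`
absorbs that growth. Elsewhere `(1 + U)⁻² < ε`, and `B_ε` decays faster than every power of `1 + U`,
uniformly for small `ε` (`rescaledIntegrand_decay`), so the contribution is `O(ε^N)`. Hence the
integral expands term by term (`isBigO_integral_sub_sum`).

Uniqueness of asymptotic coefficients merges the expansions of all orders into one sequence
(`exists_coeff_of_forall_polynomial`). Its constant term, the integral with `exp(-U)`, is a Gamma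
quotient (`leadingIntegral_eq`); dividing by it gives `a₀ = 1`. -/

/-! ### Gamma and Beta integrals over the half line. -/

/-- The `lintegral` form lets later exchanges of integrals rest on Tonelli, with no integrability to
check. -/
theorem lintegral_rpow_mul_exp_neg_mul_Ioi {a r : ℝ} (ha : 0 < a) (hr : 0 < r) :
    ∫⁻ z in Ioi (0 : ℝ), ENNReal.ofReal (z ^ (a - 1) * Real.exp (-(r * z))) =
      ENNReal.ofReal ((1 / r) ^ a * Real.Gamma a) := by
  have h0 : 0 < (1 / r) ^ a * Real.Gamma a :=
    mul_pos (Real.rpow_pos_of_pos (by positivity) _) (Real.Gamma_pos_of_pos ha)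
  have hI := Real.integral_rpow_mul_exp_neg_mul_Ioi ha hr
  have hint : Integrable (fun z : ℝ => z ^ (a - 1) * Real.exp (-(r * z)))
      (volume.restrict (Ioi 0)) := by
    -- A non-integrable function would have Bochner integral `0`, but the known value is positive.
    by_contra h
    rw [integral_undef h] at hI
    exact h0.ne hI
  rw [← ofReal_integral_eq_lintegral_ofReal hint, hI]
  filter_upwards [ae_restrict_mem measurableSet_Ioi] with z hz
  have : (0 : ℝ) < z := hz
  positivity

/-- The Beta integral over the half line. -/
theorem lintegral_rpow_mul_one_add_rpow {a b : ℝ} (ha : 0 < a) (hb : 0 < b) :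
    ∫⁻ w in Ioi (0 : ℝ), ENNReal.ofReal (w ^ (a - 1) * (1 + w) ^ (-(a + b))) =
      ENNReal.ofReal (Real.Gamma a * Real.Gamma b / Real.Gamma (a + b)) := by
  have hab : 0 < a + b := add_pos ha hb
  have hG := Real.Gamma_pos_of_pos hab
  have key : ENNReal.ofReal (Real.Gamma (a + b)) *
      ∫⁻ w in Ioi (0 : ℝ), ENNReal.ofReal (w ^ (a - 1) * (1 + w) ^ (-(a + b))) =
      ENNReal.ofReal (Real.Gamma a * Real.Gamma b) := by
    -- `Γ(a+b) (1+w)^(-(a+b))` is the Gamma integral of `z^(a+b-1) exp(-(1+w)z)`; after Tonelli the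
    -- `w`-integral is again a Gamma integral.
    calc _ = ∫⁻ w in Ioi (0 : ℝ), ∫⁻ z in Ioi (0 : ℝ),
          ENNReal.ofReal (w ^ (a - 1) * (z ^ (a + b - 1) * Real.exp (-((1 + w) * z)))) := by
          rw [← lintegral_const_mul' _ _ ENNReal.ofReal_ne_top]
          refine setLIntegral_congr_fun measurableSet_Ioi fun w hw => ?_
          have hw : (0 : ℝ) < w := hw
          simp only [ENNReal.ofReal_mul (Real.rpow_nonneg hw.le (a - 1))]
          rw [lintegral_const_mul' _ _ ENNReal.ofReal_ne_top,
            lintegral_rpow_mul_exp_neg_mul_Ioi hab (by linarith),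
            ← ENNReal.ofReal_mul (Real.rpow_nonneg hw.le (a - 1)),
            ← ENNReal.ofReal_mul (Real.rpow_nonneg hw.le (a - 1)), ← ENNReal.ofReal_mul hG.le,
            Real.rpow_neg (by linarith), one_div, Real.inv_rpow (by linarith)]
          ring_nf
      _ = ∫⁻ z in Ioi (0 : ℝ), ∫⁻ w in Ioi (0 : ℝ),
          ENNReal.ofReal (w ^ (a - 1) * (z ^ (a + b - 1) * Real.exp (-((1 + w) * z)))) := by
          rw [lintegral_lintegral_swap]
          exact Measurable.aemeasurable (by unfold Function.uncurry; fun_prop)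
      _ = ∫⁻ z in Ioi (0 : ℝ), ENNReal.ofReal (Real.Gamma a) *
            ENNReal.ofReal (z ^ (b - 1) * Real.exp (-(1 * z))) := by
          refine setLIntegral_congr_fun measurableSet_Ioi fun z hz => ?_
          have hz : (0 : ℝ) < z := hz
          have : ∀ w : ℝ, w ^ (a - 1) * (z ^ (a + b - 1) * Real.exp (-((1 + w) * z))) =
              (z ^ (a + b - 1) * Real.exp (-z)) * (w ^ (a - 1) * Real.exp (-(z * w))) := by
            intro w
            rw [show -((1 + w) * z) = -z + -(z * w) by ring, Real.exp_add]
            ring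
          simp only [this]
          have h0 : 0 ≤ z ^ (a + b - 1) * Real.exp (-z) := by positivity
          simp only [ENNReal.ofReal_mul h0]
          rw [lintegral_const_mul' _ _ ENNReal.ofReal_ne_top,
            lintegral_rpow_mul_exp_neg_mul_Ioi ha hz, ← ENNReal.ofReal_mul h0,
            ← ENNReal.ofReal_mul (Real.Gamma_pos_of_pos ha).le]
          congr 1
          rw [show a + b - 1 = (b - 1) + a by ring, Real.rpow_add hz, one_div, Real.inv_rpow hz.le,
            one_mul]
          have := (Real.rpow_pos_of_pos hz a).ne'
          field_simp
      _ = _ := by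
          rw [lintegral_const_mul' _ _ ENNReal.ofReal_ne_top,
            lintegral_rpow_mul_exp_neg_mul_Ioi hb one_pos,
            ← ENNReal.ofReal_mul (Real.Gamma_pos_of_pos ha).le]
          simp
  rw [ENNReal.ofReal_div_of_pos hG, ← key, mul_comm, ENNReal.mul_div_cancel_right]
  · simpa using hG
  · exact ENNReal.ofReal_ne_top

theorem integrableOn_rpow_mul_one_add_rpow {a b : ℝ} (ha : 0 < a) (hb : 0 < b) :
    IntegrableOn (fun w : ℝ => w ^ (a - 1) * (1 + w) ^ (-(a + b))) (Ioi 0) := by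
  refine ⟨Measurable.aestronglyMeasurable (by fun_prop), ?_⟩
  rw [hasFiniteIntegral_iff_ofReal, lintegral_rpow_mul_one_add_rpow ha hb]
  · exact ENNReal.ofReal_lt_top
  · filter_upwards [ae_restrict_mem measurableSet_Ioi] with z hz
    have : (0 : ℝ) < z := hz
    positivity

theorem integral_rpow_mul_one_add_rpow {a b : ℝ} (ha : 0 < a) (hb : 0 < b) :
    ∫ w in Ioi (0 : ℝ), w ^ (a - 1) * (1 + w) ^ (-(a + b)) =
      Real.Gamma a * Real.Gamma b / Real.Gamma (a + b) := by
  rw [integral_eq_lintegral_of_nonneg_ae, lintegral_rpow_mul_one_add_rpow ha hb,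
    ENNReal.toReal_ofReal]
  · have := Real.Gamma_pos_of_pos ha
    have := Real.Gamma_pos_of_pos hb
    have := Real.Gamma_pos_of_pos (add_pos ha hb)
    positivity
  · filter_upwards [ae_restrict_mem measurableSet_Ioi] with z hz
    have : (0 : ℝ) < z := hz
    simp only [Pi.zero_apply]
    positivity
  · exact (integrableOn_rpow_mul_one_add_rpow ha hb).aestronglyMeasurable

/-! ### Binomial series and Euler's integral for `₂F₁`. -/

theorem Real.Gamma_add_nat_eq_ascPochhammer {z : ℝ} (hz : 0 < z) (k : ℕ) :
    Real.Gamma (z + k) = (ascPochhammer ℝ k).eval z * Real.Gamma z := by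
  induction k with
  | zero => simp
  | succ k ih =>
    rw [Nat.cast_succ, ← add_assoc, Real.Gamma_add_one (by positivity), ih,
      ascPochhammer_succ_eval]
    ring

theorem hasSum_one_sub_rpow_neg (p : ℝ) {z : ℝ} (hz : |z| < 1) :
    HasSum (fun k : ℕ => (ascPochhammer ℝ k).eval p / k.factorial * z ^ k) ((1 - z) ^ (-p)) := by
  have h := (Real.one_div_one_sub_rpow_hasFPowerSeriesOnBall_zero p).hasSum (y := z)
    (by simpa [← ofReal_norm] using hz)
  simp only [zero_add, FormalMultilinearSeries.ofScalars_apply_eq, smul_eq_mul] at h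
  rw [Real.rpow_neg (by linarith [(abs_lt.1 hz).2]), ← one_div]
  refine (congrArg (HasSum · _) (funext fun k => ?_)).mpr h
  rw [Ring.choose_eq_smul, Polynomial.descPochhammer_smeval_eq_ascPochhammer,
    Polynomial.ascPochhammer_smeval_cast, Polynomial.ascPochhammer_smeval_eq_eval]
  simp [show p + k - 1 - k + 1 = p by ring, div_eq_inv_mul]

theorem summable_ordinaryHypergeometric {a b c : ℝ} (ha : 0 < a) (hb : 0 < b) (hc : 0 < c)
    {t : ℝ} (ht : |t| < 1) :
    Summable fun k : ℕ => ((k.factorial : ℝ)⁻¹ * (ascPochhammer ℝ k).eval a *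
      (ascPochhammer ℝ k).eval b * ((ascPochhammer ℝ k).eval c)⁻¹) * t ^ k := by
  have hr := ordinaryHypergeometricSeries_radius_eq_one ℝ a b c
    (fun k => by have : (0 : ℝ) ≤ k := k.cast_nonneg
                 refine ⟨?_, ?_, ?_⟩ <;> linarith)
  have := (ordinaryHypergeometricSeries ℝ a b c).summable (x := t)
    (by rw [hr]; simpa [← ofReal_norm] using ht)
  simpa only [ordinaryHypergeometricSeries_apply_eq', smul_eq_mul] using this

/-- Euler's integral for `₂F₁(p, q; p+q+m; 1-σ)`, over the half line. -/
theorem ordinaryHypergeometric_eq_integral {p q m σ : ℝ} (hp : 0 < p) (hq : 0 < q) (hm : 0 < m)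
    (hσ : 0 < σ) (hσ1 : σ < 1) :
    Real.Gamma (m + p) * Real.Gamma (m + q) / (Real.Gamma m * Real.Gamma (m + p + q)) *
        ordinaryHypergeometric p q (p + q + m) (1 - σ) =
      Real.Gamma (m + q) / (Real.Gamma m * Real.Gamma q) *
        ∫ w in Ioi (0 : ℝ), w ^ (m - 1) * (1 + w) ^ (-(q + m)) * (1 + σ / w) ^ (-p) := by
  set t := 1 - σ with ht
  have ht0 : 0 < t := by linarith
  have ht1 : t < 1 := by linarith
  set c : ℕ → ℝ := fun k => (ascPochhammer ℝ k).eval p / k.factorial * t ^ k with hc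
  have hc0 : ∀ k, 0 ≤ c k := fun k => by
    have := ascPochhammer_pos k p hp
    positivity
  -- Terms of the binomial series of `(1 - t/(1+w))^(-p)`, obtained from `1 + σ/w = (1+w)(1 -
  -- t/(1+w))/w`. Each integrates to a Beta value, which is a multiple of the `k`-th hypergeometric
  -- term; as all terms are nonnegative, convergence of that series justifies the exchange of sum
  -- and integral.
  let f : ℕ → ℝ → ℝ := fun k w => c k * (w ^ (m + p - 1) * (1 + w) ^ (-(m + p + (q + k))))
  have hf0 : ∀ k, ∀ w ∈ Ioi (0 : ℝ), 0 ≤ f k w := fun k w hw => by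
    have : (0 : ℝ) < w := hw
    have := hc0 k
    positivity
  have hqk : ∀ k : ℕ, 0 < q + k := fun k => by positivity
  have hint : ∀ k, Integrable (f k) (volume.restrict (Ioi 0)) := fun k =>
    (integrableOn_rpow_mul_one_add_rpow (add_pos hm hp) (hqk k)).const_mul _
  have hG : 0 < Real.Gamma (m + p + q) := Real.Gamma_pos_of_pos (by positivity)
  have hval : ∀ k, ∫ w in Ioi (0 : ℝ), f k w =
      Real.Gamma (m + p) * Real.Gamma q / Real.Gamma (m + p + q) *
        (((k.factorial : ℝ)⁻¹ * (ascPochhammer ℝ k).eval p *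
      (ascPochhammer ℝ k).eval q * ((ascPochhammer ℝ k).eval (p + q + m))⁻¹) * t ^ k) := fun k => by
    have h1 : ∫ w in Ioi (0 : ℝ), f k w = c k * ∫ w in Ioi (0 : ℝ),
        w ^ (m + p - 1) * (1 + w) ^ (-(m + p + (q + k))) := integral_const_mul _ _
    rw [h1, integral_rpow_mul_one_add_rpow (add_pos hm hp) (hqk k),
      Real.Gamma_add_nat_eq_ascPochhammer hq, ← add_assoc,
      Real.Gamma_add_nat_eq_ascPochhammer (by positivity), show p + q + m = m + p + q by ring]
    have := ascPochhammer_pos k (m + p + q) (by positivity)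
    simp only [hc]
    field_simp
  have hsum := summable_ordinaryHypergeometric hp hq (c := p + q + m) (by positivity)
    (t := t) (by rw [abs_of_pos ht0]; exact ht1)
  have hnorm : ∀ k, ∫ w in Ioi (0 : ℝ), ‖f k w‖ = ∫ w in Ioi (0 : ℝ), f k w := fun k =>
    setIntegral_congr_fun measurableSet_Ioi fun w hw => Real.norm_of_nonneg (hf0 k w hw)
  have hs := hasSum_integral_of_summable_integral_norm hint (by
    simp only [hnorm, hval]
    exact hsum.mul_left _)
  have hpt : ∫ w in Ioi (0 : ℝ), ∑' k, f k w =
      ∫ w in Ioi (0 : ℝ), w ^ (m - 1) * (1 + w) ^ (-(q + m)) * (1 + σ / w) ^ (-p) := by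
    refine setIntegral_congr_fun measurableSet_Ioi fun w hw => ?_
    have hw : (0 : ℝ) < w := hw
    have h1w : 0 < 1 + w := by linarith
    have hz : t / (1 + w) < 1 := by rw [div_lt_one h1w]; linarith
    have h := hasSum_one_sub_rpow_neg p (z := t / (1 + w))
      (by rw [abs_of_pos (by positivity)]; exact hz)
    have h2 := h.mul_left (w ^ (m + p - 1) * (1 + w) ^ (-(m + p + q)))
    have h3 : ∀ k : ℕ, f k w = w ^ (m + p - 1) * (1 + w) ^ (-(m + p + q)) *
        ((ascPochhammer ℝ k).eval p / k.factorial * (t / (1 + w)) ^ k) := fun k => by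
      simp only [f, hc]
      rw [show -(m + p + (q + k)) = -(m + p + q) - (k : ℝ) by ring, Real.rpow_sub h1w,
        Real.rpow_natCast, div_pow]
      field_simp
    simp only [h3]
    rw [h2.tsum_eq]
    have h4 : 1 + σ / w = (1 + w) * (1 - t / (1 + w)) / w := by
      rw [ht]; field_simp; ring
    have h5 : 0 < 1 - t / (1 + w) := by linarith
    rw [h4, Real.div_rpow (by positivity) hw.le, Real.mul_rpow h1w.le h5.le,
      show -(m + p + q) = -(q + m) + -p by ring, Real.rpow_add h1w,
      show m + p - 1 = m - 1 + p by ring, Real.rpow_add hw, Real.rpow_neg hw.le]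
    field_simp
  rw [← hpt, ← hs.tsum_eq]
  simp only [hval]
  rw [tsum_mul_left, ordinaryHypergeometric_eq_tsum]
  simp only [smul_eq_mul]
  have := Real.Gamma_pos_of_pos hq
  have := Real.Gamma_pos_of_pos hm
  field_simp

/-! ### Expansions in `ε`, uniform up to polynomial growth in the phase. -/

section UniformExpansion

variable {X : Type*} (U : X → ℝ) (Ω : Set X)

/-- The weight `1 + |U|` against which polynomial growth is measured. -/
def growthWeight (x : X) : ℝ := 1 + |U x|

theorem one_le_growthWeight (x : X) : 1 ≤ growthWeight U x := by
  have := abs_nonneg (U x)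
  unfold growthWeight
  linarith

theorem growthWeight_pos (x : X) : 0 < growthWeight U x :=
  one_pos.trans_le (one_le_growthWeight U x)

/-- Small parameter `ε > 0` and `x ∈ Ω` with `ε (1 + |U x|)² ≤ 1`. -/
def smallParamFilter : Filter (ℝ × X) :=
  (𝓝[>] 0 ×ˢ 𝓟 Ω) ⊓ 𝓟 {z | z.1 * growthWeight U z.2 ^ 2 ≤ 1}

variable {U Ω}

theorem eventually_smallParamFilter {P : ℝ × X → Prop} :
    (∀ᶠ z in smallParamFilter U Ω, P z) ↔
      ∀ᶠ ε in 𝓝[>] (0 : ℝ), ∀ x ∈ Ω, ε * growthWeight U x ^ 2 ≤ 1 → P (ε, x) := by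
  rw [smallParamFilter, eventually_inf_principal, eventually_prod_principal_iff]
  rfl

theorem eventually_pos_smallParamFilter :
    ∀ᶠ z in smallParamFilter U Ω, 0 < z.1 ∧ z.1 < 1 ∧ z.2 ∈ Ω ∧
      z.1 * growthWeight U z.2 ^ 2 ≤ 1 := by
  rw [eventually_smallParamFilter]
  filter_upwards [Ioo_mem_nhdsGT (zero_lt_one' ℝ)] with ε hε x hx h
  exact ⟨hε.1, hε.2, hx, h⟩

variable (U Ω) in
/-- `F(ε, x) = O(ε ^ N)`, up to polynomial growth in `x`. -/
def IsRemainder (N : ℕ) (F : ℝ × X → ℝ) : Prop :=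
  ∃ K : ℕ, F =O[smallParamFilter U Ω] fun z => growthWeight U z.2 ^ K * z.1 ^ N

theorem isBigO_growthWeight_pow {K K' N N' : ℕ} (hK : K ≤ K') (hN : N' ≤ N) :
    (fun z : ℝ × X => growthWeight U z.2 ^ K * z.1 ^ N) =O[smallParamFilter U Ω]
      fun z => growthWeight U z.2 ^ K' * z.1 ^ N' := by
  refine IsBigO.of_bound 1 ?_
  filter_upwards [eventually_pos_smallParamFilter] with z hz
  have h0 := growthWeight_pos U z.2
  have h1 := hz.1
  rw [Real.norm_of_nonneg (by positivity), Real.norm_of_nonneg (by positivity), one_mul]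
  exact mul_le_mul (pow_le_pow_right₀ (one_le_growthWeight U _) hK)
    (pow_le_pow_of_le_one h1.le hz.2.1.le hN) (by positivity) (by positivity)

theorem IsRemainder.add {N : ℕ} {F G : ℝ × X → ℝ} (hF : IsRemainder U Ω N F)
    (hG : IsRemainder U Ω N G) : IsRemainder U Ω N (fun z => F z + G z) := by
  obtain ⟨K, hK⟩ := hF
  obtain ⟨M, hM⟩ := hG
  exact ⟨max K M, (hK.trans (isBigO_growthWeight_pow (le_max_left K M) le_rfl)).add
    (hM.trans (isBigO_growthWeight_pow (le_max_right K M) le_rfl))⟩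

theorem IsRemainder.mul {N M : ℕ} {F G : ℝ × X → ℝ} (hF : IsRemainder U Ω N F)
    (hG : IsRemainder U Ω M G) : IsRemainder U Ω (N + M) (fun z => F z * G z) := by
  obtain ⟨K, hK⟩ := hF
  obtain ⟨L, hL⟩ := hG
  refine ⟨K + L, (hK.mul hL).congr_right fun z => ?_⟩
  ring

theorem IsRemainder.mono {N M : ℕ} (h : M ≤ N) {F : ℝ × X → ℝ} (hF : IsRemainder U Ω N F) :
    IsRemainder U Ω M F := by
  obtain ⟨K, hK⟩ := hF
  exact ⟨K, hK.trans (isBigO_growthWeight_pow le_rfl h)⟩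

theorem IsRemainder.congr {N : ℕ} {F G : ℝ × X → ℝ} (hF : IsRemainder U Ω N F)
    (h : F =ᶠ[smallParamFilter U Ω] G) : IsRemainder U Ω N G := by
  obtain ⟨K, hK⟩ := hF
  exact ⟨K, hK.congr' h EventuallyEq.rfl⟩

theorem isRemainder_zero (N : ℕ) : IsRemainder U Ω N fun _ => 0 :=
  ⟨0, isBigO_zero _ _⟩

/-- Since `ε (1+|U|)² ≤ 1` on the region, `F` is bounded there, so the exponential tail is at most a
constant times `|F|^N`. -/
theorem isRemainder_exp_sub_sum {F : ℝ × X → ℝ}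
    (hs : F =O[smallParamFilter U Ω] fun z => growthWeight U z.2 ^ 2 * z.1) (N : ℕ) :
    IsRemainder U Ω N fun z =>
      Real.exp (F z) - ∑ k ∈ Finset.range N, (k.factorial : ℝ)⁻¹ * F z ^ k := by
  obtain ⟨C, hC0, hC⟩ := hs.exists_nonneg
  refine ⟨2 * N, IsBigO.of_bound (C ^ N * Real.exp C) ?_⟩
  filter_upwards [hC.bound, eventually_pos_smallParamFilter] with z hz ⟨h0, h1, hx, hr⟩
  have hw := growthWeight_pos U z.2
  rw [Real.norm_of_nonneg (r := growthWeight U z.2 ^ 2 * z.1) (by positivity)] at hz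
  have hFC : ‖F z‖ ≤ C := hz.trans (by nlinarith)
  have hexp := Complex.norm_exp_sub_sum_le_norm_mul_exp (F z : ℂ) N
  have hcast : Complex.exp (F z) - ∑ m ∈ Finset.range N, (F z : ℂ) ^ m / m.factorial =
      ((Real.exp (F z) - ∑ k ∈ Finset.range N, (k.factorial : ℝ)⁻¹ * F z ^ k : ℝ) : ℂ) := by
    push_cast
    simp only [div_eq_inv_mul]
  rw [hcast, Complex.norm_real, Complex.norm_real] at hexp
  rw [Real.norm_of_nonneg (r := growthWeight U z.2 ^ (2 * N) * z.1 ^ N) (by positivity)]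
  calc _ ≤ ‖F z‖ ^ N * Real.exp ‖F z‖ := hexp
    _ ≤ (C * (growthWeight U z.2 ^ 2 * z.1)) ^ N * Real.exp C := by gcongr
    _ = _ := by rw [mul_pow, mul_pow, ← pow_mul]; ring

/-- Linear growth of `F` is what the region tolerates: `(ε F)² ≤ C² ε · ε (1+|U|)² ≤ C² ε`, so `ε F`
is uniformly small and the Taylor remainder of `log` applies. Dividing by `ε` costs one power, hence
the exponent `N + 1` on the weight against `N` on `ε`. -/
theorem eventually_log_bounds {F : ℝ × X → ℝ} {C : ℝ}
    (hF : ∀ᶠ z in smallParamFilter U Ω, |F z| ≤ C * growthWeight U z.2) :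
    ∀ᶠ z in smallParamFilter U Ω, |z.1 * F z| ≤ 1 / 2 ∧ ∀ N : ℕ,
      |Real.log (1 + z.1 * F z) / z.1 -
        ∑ i ∈ Finset.range N, (-1) ^ i / (i + 1 : ℝ) * (z.1 ^ i * F z ^ (i + 1))| ≤
        2 * C ^ (N + 1) * (growthWeight U z.2 ^ (N + 1) * z.1 ^ N) := by
  -- The factor `4` yields `(ε F)² ≤ 1/4`.
  have hsmall : ∀ᶠ z in smallParamFilter U Ω, 4 * C ^ 2 * z.1 ≤ 1 := by
    rw [eventually_smallParamFilter]
    have : Tendsto (fun ε : ℝ => 4 * C ^ 2 * ε) (𝓝[>] 0) (𝓝 (4 * C ^ 2 * 0)) :=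
      ((continuous_const.mul continuous_id).tendsto _).mono_left nhdsWithin_le_nhds
    filter_upwards [this.eventually_le_const (u := 1) (by simp)] with ε h x _ _
    exact h
  filter_upwards [hF, hsmall, eventually_pos_smallParamFilter] with z hz hs ⟨h0, h1, hx, hr⟩
  have hw := growthWeight_pos U z.2
  have hC0 : 0 ≤ C := nonneg_of_mul_nonneg_left ((abs_nonneg _).trans hz) hw
  have hbd : |z.1 * F z| ≤ C * growthWeight U z.2 * z.1 := by
    rw [abs_mul, abs_of_pos h0, mul_comm]
    gcongr
  have hhalf : |z.1 * F z| ≤ 1 / 2 := by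
    refine abs_le_of_sq_le_sq ?_ (by norm_num)
    calc (z.1 * F z) ^ 2 = |z.1 * F z| ^ 2 := (sq_abs _).symm
      _ ≤ (C * growthWeight U z.2 * z.1) ^ 2 := by gcongr
      _ = (4 * C ^ 2 * z.1) * (z.1 * growthWeight U z.2 ^ 2) / 4 := by ring
      _ ≤ 1 * 1 / 4 := by gcongr
      _ = _ := by norm_num
  refine ⟨hhalf, fun N => ?_⟩
  have hlog := Real.abs_log_sub_add_sum_range_le (x := -(z.1 * F z))
    (by rw [abs_neg]; linarith) N
  rw [abs_neg, sub_neg_eq_add] at hlog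
  have hrew : Real.log (1 + z.1 * F z) / z.1 -
      ∑ i ∈ Finset.range N, (-1) ^ i / (i + 1 : ℝ) * (z.1 ^ i * F z ^ (i + 1)) =
      (∑ i ∈ Finset.range N, (-(z.1 * F z)) ^ (i + 1) / (i + 1) +
        Real.log (1 + z.1 * F z)) / z.1 := by
    have : (∑ i ∈ Finset.range N, (-(z.1 * F z)) ^ (i + 1) / (i + 1 : ℝ)) / z.1 =
        -∑ i ∈ Finset.range N, (-1) ^ i / (i + 1 : ℝ) * (z.1 ^ i * F z ^ (i + 1)) := by
      rw [Finset.sum_div, ← Finset.sum_neg_distrib]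
      refine Finset.sum_congr rfl fun i _ => ?_
      rw [neg_pow, mul_pow, pow_succ (-1 : ℝ), pow_succ z.1]
      field_simp
    rw [add_div, this]
    ring
  rw [hrew, abs_div, abs_of_pos h0, div_le_iff₀ h0]
  calc _ ≤ |z.1 * F z| ^ (N + 1) / (1 - |z.1 * F z|) := hlog
    _ ≤ (C * growthWeight U z.2 * z.1) ^ (N + 1) / (1 / 2) := by
        gcongr
        linarith
    _ = _ := by rw [mul_pow, mul_pow]; ring

theorem isBigO_log_div_sub {F : ℝ × X → ℝ} {C : ℝ}
    (hC : ∀ᶠ z in smallParamFilter U Ω, |F z| ≤ C * growthWeight U z.2) :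
    (fun z => Real.log (1 + z.1 * F z) / z.1 - F z) =O[smallParamFilter U Ω]
      fun z => growthWeight U z.2 ^ 2 * z.1 := by
  refine IsBigO.of_bound (2 * C ^ 2) ?_
  filter_upwards [eventually_log_bounds hC, eventually_pos_smallParamFilter] with z hz hp
  have hw := growthWeight_pos U z.2
  have h0 := hp.1
  rw [Real.norm_of_nonneg (r := growthWeight U z.2 ^ 2 * z.1) (by positivity)]
  simpa using hz.2 1

/-- From `w^k / k! ≤ exp w` at `w = 1 + U` and `k = K + M`; the factor `exp 1` comes from the `1` in
the weight. -/
theorem exp_neg_mul_growthWeight_pow_le {x : X} (hx : 0 ≤ U x) (K M : ℕ) :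
    Real.exp (-U x) * growthWeight U x ^ K ≤
      ((K + M).factorial * Real.exp 1) * (growthWeight U x ^ M)⁻¹ := by
  have hw := growthWeight_pos U x
  have h := Real.pow_div_factorial_le_exp _ hw.le (K + M)
  have hU : Real.exp (growthWeight U x) = Real.exp 1 * Real.exp (U x) := by
    rw [growthWeight, abs_of_nonneg hx, Real.exp_add]
  have hf : (0 : ℝ) < (K + M).factorial := by exact_mod_cast Nat.factorial_pos _
  rw [div_le_iff₀ hf, hU, pow_add] at h
  rw [← div_eq_mul_inv, le_div_iff₀ (by positivity), Real.exp_neg, mul_assoc,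
    inv_mul_le_iff₀ (Real.exp_pos _)]
  linarith

variable [MeasurableSpace X]

/-- Measurable functions whose growth on `Ω` is at most polynomial in `growthWeight U`. -/
def temperedFunctions (U : X → ℝ) (Ω : Set X) : Subalgebra ℝ (X → ℝ) where
  carrier := {f | Measurable f ∧ ∃ (C : ℝ) (K : ℕ), ∀ x ∈ Ω, |f x| ≤ C * growthWeight U x ^ K}
  mul_mem' := by
    rintro f g ⟨hf, C, K, h⟩ ⟨hg, D, M, k⟩
    refine ⟨hf.mul hg, C * D, K + M, fun x hx => ?_⟩
    rw [Pi.mul_apply, abs_mul, pow_add, mul_mul_mul_comm]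
    exact mul_le_mul (h x hx) (k x hx) (abs_nonneg _) ((abs_nonneg _).trans (h x hx))
  add_mem' := by
    rintro f g ⟨hf, C, K, h⟩ ⟨hg, D, M, k⟩
    refine ⟨hf.add hg, |C| + |D|, max K M, fun x hx => ?_⟩
    have hK := pow_le_pow_right₀ (one_le_growthWeight U x) (le_max_left K M)
    have hM := pow_le_pow_right₀ (one_le_growthWeight U x) (le_max_right K M)
    have h0 := growthWeight_pos U x
    rw [Pi.add_apply, add_mul]
    refine (abs_add_le _ _).trans (add_le_add ((h x hx).trans ?_) ((k x hx).trans ?_))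
    · exact mul_le_mul (le_abs_self C) hK (by positivity) (abs_nonneg C)
    · exact mul_le_mul (le_abs_self D) hM (by positivity) (abs_nonneg D)
  algebraMap_mem' := fun r => ⟨measurable_const, |r|, 0, fun x _ => by simp⟩

/-- The value at `(ε, x)` of a polynomial in `ε` with tempered coefficients. -/
noncomputable def polyFamily (P : Polynomial (temperedFunctions U Ω)) (z : ℝ × X) : ℝ :=
  (P.eval (algebraMap ℝ (temperedFunctions U Ω) z.1) : temperedFunctions U Ω).1 z.2

theorem polyFamily_eq_sum (P : Polynomial (temperedFunctions U Ω)) (z : ℝ × X) :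
    polyFamily P z = ∑ j ∈ Finset.range (P.natDegree + 1), z.1 ^ j * (P.coeff j).1 z.2 := by
  rw [polyFamily, Polynomial.eval_eq_sum_range]
  simp only [← map_pow, mul_comm (P.coeff _)]
  simp [Finset.sum_apply]

theorem exists_polyFamily_bound (P : Polynomial (temperedFunctions U Ω)) :
    ∃ (C : ℝ) (K : ℕ), 0 ≤ C ∧ ∀ ε : ℝ, 0 < ε → ε < 1 → ∀ x ∈ Ω,
      |polyFamily P (ε, x)| ≤ C * growthWeight U x ^ K := by
  have h : ∀ j, ∃ (C : ℝ) (K : ℕ), ∀ x ∈ Ω, |(P.coeff j).1 x| ≤ C * growthWeight U x ^ K :=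
    fun j => (P.coeff j).2.2
  choose C K h using h
  refine ⟨∑ j ∈ Finset.range (P.natDegree + 1), |C j|,
    ∑ j ∈ Finset.range (P.natDegree + 1), K j, by positivity, fun ε h0 h1 x hx => ?_⟩
  rw [polyFamily_eq_sum, Finset.sum_mul]
  refine (Finset.abs_sum_le_sum_abs _ _).trans (Finset.sum_le_sum fun j hj => ?_)
  have hw := growthWeight_pos U x
  rw [abs_mul, abs_of_pos (by positivity)]
  calc ε ^ j * |(P.coeff j).1 x| ≤ 1 * |(P.coeff j).1 x| := by
        gcongr
        exact pow_le_one₀ h0.le h1.le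
    _ ≤ C j * growthWeight U x ^ K j := by rw [one_mul]; exact h j x hx
    _ ≤ |C j| * growthWeight U x ^ _ := by
        refine mul_le_mul (le_abs_self _) (pow_le_pow_right₀ (one_le_growthWeight U x) ?_)
          (by positivity) (abs_nonneg _)
        exact Finset.single_le_sum (f := K) (fun _ _ => Nat.zero_le _) hj

theorem isRemainder_polyFamily (P : Polynomial (temperedFunctions U Ω)) :
    IsRemainder U Ω 0 (polyFamily P) := by
  obtain ⟨C, K, -, h⟩ := exists_polyFamily_bound P
  refine ⟨K, IsBigO.of_bound C ?_⟩
  filter_upwards [eventually_pos_smallParamFilter] with z hz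
  have h0 := growthWeight_pos U z.2
  rw [pow_zero, mul_one, Real.norm_of_nonneg (r := growthWeight U z.2 ^ K) (by positivity)]
  exact h z.1 hz.1 hz.2.1 z.2 hz.2.2.1

variable (U Ω) in
/-- `F` has an expansion in powers of `ε` up to order `N`, uniformly up to polynomial growth. -/
def HasUniformExpansion (N : ℕ) (F : ℝ × X → ℝ) : Prop :=
  ∃ P : Polynomial (temperedFunctions U Ω), IsRemainder U Ω N fun z => F z - polyFamily P z

namespace HasUniformExpansion

variable {N : ℕ} {F G : ℝ × X → ℝ}

theorem of_isRemainder (hF : IsRemainder U Ω N F) : HasUniformExpansion U Ω N F :=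
  ⟨0, by simpa [polyFamily] using hF⟩

theorem isRemainder (hF : HasUniformExpansion U Ω N F) : IsRemainder U Ω 0 F := by
  obtain ⟨P, hP⟩ := hF
  simpa using (hP.mono (Nat.zero_le N)).add (isRemainder_polyFamily P)

theorem congr (hF : HasUniformExpansion U Ω N F) (h : F =ᶠ[smallParamFilter U Ω] G) :
    HasUniformExpansion U Ω N G := by
  obtain ⟨P, hP⟩ := hF
  exact ⟨P, hP.congr (h.mono fun z hz => by simp only [hz])⟩

theorem add (hF : HasUniformExpansion U Ω N F) (hG : HasUniformExpansion U Ω N G) :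
    HasUniformExpansion U Ω N fun z => F z + G z := by
  obtain ⟨P, hP⟩ := hF
  obtain ⟨Q, hQ⟩ := hG
  refine ⟨P + Q, (hP.add hQ).congr (Eventually.of_forall fun z => ?_)⟩
  simp only [polyFamily, Polynomial.eval_add]
  simp only [Subalgebra.coe_add, Pi.add_apply]
  ring

/-- `F G - P Q = (F - P) G + P (G - Q)`, where `G` and `P` grow polynomially. The degree of the
polynomial is not limited by `N`, so products need no truncation. -/
theorem mul (hF : HasUniformExpansion U Ω N F) (hG : HasUniformExpansion U Ω N G) :
    HasUniformExpansion U Ω N fun z => F z * G z := by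
  have hG0 := hG.isRemainder
  obtain ⟨P, hP⟩ := hF
  obtain ⟨Q, hQ⟩ := hG
  have h1 := hP.mul hG0
  have h2 := (isRemainder_polyFamily P).mul hQ
  rw [Nat.add_zero] at h1
  rw [Nat.zero_add] at h2
  refine ⟨P * Q, (h1.add h2).congr (Eventually.of_forall fun z => ?_)⟩
  simp only [polyFamily, Polynomial.eval_mul]
  simp only [Subalgebra.coe_mul, Pi.mul_apply]
  ring

theorem tempered {f : X → ℝ} (hf : f ∈ temperedFunctions U Ω) :
    HasUniformExpansion U Ω N fun z => f z.2 :=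
  ⟨Polynomial.C ⟨f, hf⟩, by simpa [polyFamily] using isRemainder_zero N⟩

theorem const (c : ℝ) : HasUniformExpansion U Ω N fun _ => c :=
  tempered (f := fun _ => c) ((temperedFunctions U Ω).algebraMap_mem c)

theorem param : HasUniformExpansion U Ω N fun z => z.1 :=
  ⟨Polynomial.X, by simpa [polyFamily] using isRemainder_zero N⟩

theorem const_mul (c : ℝ) (hF : HasUniformExpansion U Ω N F) :
    HasUniformExpansion U Ω N fun z => c * F z :=
  (const c).mul hF

theorem pow (hF : HasUniformExpansion U Ω N F) (k : ℕ) :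
    HasUniformExpansion U Ω N fun z => F z ^ k := by
  induction k with
  | zero => simpa using const 1
  | succ k ih => simpa only [pow_succ] using ih.mul hF

theorem sum {ι : Type*} (s : Finset ι) {F : ι → ℝ × X → ℝ}
    (h : ∀ i ∈ s, HasUniformExpansion U Ω N (F i)) :
    HasUniformExpansion U Ω N fun z => ∑ i ∈ s, F i z := by
  classical
  induction s using Finset.induction_on with
  | empty => simpa using const 0
  | insert i s hi ih =>
    simp only [Finset.sum_insert hi]
    exact (h i (Finset.mem_insert_self i s)).add
      (ih fun j hj => h j (Finset.mem_insert_of_mem hj))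

theorem prod {ι : Type*} (s : Finset ι) {F : ι → ℝ × X → ℝ}
    (h : ∀ i ∈ s, HasUniformExpansion U Ω N (F i)) :
    HasUniformExpansion U Ω N fun z => ∏ i ∈ s, F i z := by
  classical
  induction s using Finset.induction_on with
  | empty => simpa using const 1
  | insert i s hi ih =>
    simp only [Finset.prod_insert hi]
    exact (h i (Finset.mem_insert_self i s)).mul
      (ih fun j hj => h j (Finset.mem_insert_of_mem hj))

/-- The exponential of a small quantity has an expansion. -/
theorem exp (hF : HasUniformExpansion U Ω N F)
    (hs : F =O[smallParamFilter U Ω] fun z => growthWeight U z.2 ^ 2 * z.1) :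
    HasUniformExpansion U Ω N fun z => Real.exp (F z) := by
  have hsum : HasUniformExpansion U Ω N fun z =>
      ∑ k ∈ Finset.range N, (k.factorial : ℝ)⁻¹ * F z ^ k :=
    sum _ fun k _ => (hF.pow k).const_mul _
  simpa using hsum.add (of_isRemainder (isRemainder_exp_sub_sum hs N))

end HasUniformExpansion

theorem HasUniformExpansion.log {N : ℕ} {F : ℝ × X → ℝ} {C : ℝ}
    (hF : HasUniformExpansion U Ω N F)
    (hC : ∀ᶠ z in smallParamFilter U Ω, |F z| ≤ C * growthWeight U z.2) :
    HasUniformExpansion U Ω N fun z => Real.log (1 + z.1 * F z) / z.1 := by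
  have hsum : HasUniformExpansion U Ω N fun z =>
      ∑ i ∈ Finset.range N, (-1) ^ i / (i + 1 : ℝ) * (z.1 ^ i * F z ^ (i + 1)) :=
    sum _ fun i _ => ((param.pow i).mul (hF.pow (i + 1))).const_mul _
  have hrem : IsRemainder U Ω N fun z => Real.log (1 + z.1 * F z) / z.1 -
      ∑ i ∈ Finset.range N, (-1) ^ i / (i + 1 : ℝ) * (z.1 ^ i * F z ^ (i + 1)) := by
    refine ⟨N + 1, IsBigO.of_bound (2 * C ^ (N + 1)) ?_⟩
    filter_upwards [eventually_log_bounds hC, eventually_pos_smallParamFilter] with z hz hp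
    have hw := growthWeight_pos U z.2
    have h0 := hp.1
    rw [Real.norm_of_nonneg (r := growthWeight U z.2 ^ (N + 1) * z.1 ^ N) (by positivity)]
    exact hz.2 N
  simpa using hsum.add (of_isRemainder hrem)

end UniformExpansion

/-! ### Term-by-term integration of uniform expansions. -/

section UniformExpansion

variable {X : Type*} {U : X → ℝ} {Ω : Set X} [MeasurableSpace X] {μ : Measure X} {ρ : X → ℝ}

theorem integrable_mul_of_le_growthWeight {K₀ : ℕ} (hΩ : MeasurableSet Ω)
    (hρ : IntegrableOn (fun x => ρ x * (growthWeight U x ^ K₀)⁻¹) Ω μ)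
    {f : X → ℝ} (hρm : Measurable ρ) (hf : Measurable f) {C : ℝ}
    (hC : ∀ x ∈ Ω, |f x| ≤ C * (growthWeight U x ^ K₀)⁻¹) :
    IntegrableOn (fun x => ρ x * f x) Ω μ := by
  refine Integrable.mono' (hρ.norm.const_mul C) (hρm.mul hf).aestronglyMeasurable ?_
  filter_upwards [ae_restrict_mem hΩ] with x hx
  have hw := growthWeight_pos U x
  rw [norm_mul, norm_mul, Real.norm_of_nonneg (r := (growthWeight U x ^ K₀)⁻¹) (by positivity),
    mul_left_comm]
  exact mul_le_mul_of_nonneg_left (hC x hx) (norm_nonneg _)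

/-- An integral whose integrand has a uniform expansion, and decays rapidly, may be expanded
term by term. -/
theorem isBigO_integral_sub_sum {N K₀ : ℕ} (hΩ : MeasurableSet Ω) (hUm : Measurable U)
    (hU : ∀ x ∈ Ω, 0 ≤ U x) (hρm : Measurable ρ)
    (hρ : IntegrableOn (fun x => ρ x * (growthWeight U x ^ K₀)⁻¹) Ω μ)
    {B : ℝ → X → ℝ} (hBm : ∀ ε, Measurable (B ε))
    (hdecay : ∀ K : ℕ, ∃ C : ℝ, ∀ᶠ ε in 𝓝[>] (0 : ℝ), ∀ x ∈ Ω,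
      |B ε x| ≤ C * (growthWeight U x ^ K)⁻¹)
    (P : Polynomial (temperedFunctions U Ω))
    (hP : IsRemainder U Ω N fun z => B z.1 z.2 * Real.exp (U z.2) - polyFamily P z) :
    (fun ε => ∫ x in Ω, ρ x * B ε x ∂μ - ∑ j ∈ Finset.range (P.natDegree + 1),
      (∫ x in Ω, ρ x * (Real.exp (-U x) * (P.coeff j).1 x) ∂μ) * ε ^ j)
      =O[𝓝[>] (0 : ℝ)] fun ε => ε ^ N := by
  obtain ⟨K₁, hP⟩ := hP
  obtain ⟨C₁, hC₁, hP⟩ := hP.exists_nonneg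
  obtain ⟨C₂, K₂, hC₂, hP2⟩ := exists_polyFamily_bound P
  obtain ⟨C₀, hB₀⟩ := hdecay K₀
  -- `K₀` powers of the weight secure integrability; the other `2 N` are traded for `ε^N` where `ε
  -- (1+|U|)² > 1`.
  obtain ⟨C₃, hB⟩ := hdecay (K₀ + 2 * N)
  have hcoef : ∀ j, IntegrableOn (fun x => ρ x * (Real.exp (-U x) * (P.coeff j).1 x)) Ω μ := by
    intro j
    obtain ⟨hm, C, K, h⟩ := (P.coeff j).2
    refine integrable_mul_of_le_growthWeight hΩ hρ hρm (hUm.neg.exp.mul hm)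
      (C := |C| * ((K + K₀).factorial * Real.exp 1)) fun x hx => ?_
    have hw := growthWeight_pos U x
    rw [abs_mul, Real.abs_exp]
    calc _ ≤ Real.exp (-U x) * (|C| * growthWeight U x ^ K) := by
          refine mul_le_mul_of_nonneg_left ((h x hx).trans ?_) (Real.exp_pos _).le
          exact mul_le_mul_of_nonneg_right (le_abs_self C) (by positivity)
      _ = |C| * (Real.exp (-U x) * growthWeight U x ^ K) := by ring
      _ ≤ |C| * (((K + K₀).factorial * Real.exp 1) * (growthWeight U x ^ K₀)⁻¹) :=
          mul_le_mul_of_nonneg_left (exp_neg_mul_growthWeight_pow_le (hU x hx) K K₀)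
            (abs_nonneg C)
      _ = _ := by ring
  set D₁ : ℝ := C₁ * ((K₁ + K₀).factorial * Real.exp 1) with hD₁
  set D₂ : ℝ := C₂ * ((K₂ + (K₀ + 2 * N)).factorial * Real.exp 1) with hD₂
  have hD₁0 : 0 ≤ D₁ := by positivity
  have hD₂0 : 0 ≤ D₂ := by positivity
  refine IsBigO.of_bound ((D₁ + (|C₃| + D₂)) *
    ∫ x in Ω, ‖ρ x * (growthWeight U x ^ K₀)⁻¹‖ ∂μ) ?_
  filter_upwards [hB₀, hB, eventually_smallParamFilter.1 hP.bound,
    Ioo_mem_nhdsGT (zero_lt_one' ℝ)] with ε hB₀ hB hP hε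
  have h0 : 0 < ε := hε.1
  have hint : IntegrableOn (fun x => ρ x * B ε x) Ω μ :=
    integrable_mul_of_le_growthWeight hΩ hρ hρm (hBm ε) hB₀
  have hsum : ∑ j ∈ Finset.range (P.natDegree + 1),
      (∫ x in Ω, ρ x * (Real.exp (-U x) * (P.coeff j).1 x) ∂μ) * ε ^ j =
      ∫ x in Ω, ρ x * (Real.exp (-U x) * polyFamily P (ε, x)) ∂μ := by
    simp only [polyFamily_eq_sum, Finset.mul_sum]
    rw [integral_finsetSum]
    · refine Finset.sum_congr rfl fun j _ => ?_
      rw [← integral_mul_const]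
      congr 1
      ext x
      ring
    · intro j _
      refine ((hcoef j).const_mul (ε ^ j)).congr (Eventually.of_forall fun x => ?_)
      simp only
      ring
  have hintP : IntegrableOn (fun x => ρ x * (Real.exp (-U x) * polyFamily P (ε, x))) Ω μ := by
    simp only [polyFamily_eq_sum, Finset.mul_sum]
    refine integrable_finsetSum _ fun j _ => ?_
    refine ((hcoef j).const_mul (ε ^ j)).congr (Eventually.of_forall fun x => ?_)
    simp only
    ring
  rw [hsum, ← integral_sub hint hintP, Real.norm_of_nonneg (r := ε ^ N) (by positivity),
    mul_right_comm, ← integral_const_mul]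
  refine norm_integral_le_of_norm_le (hρ.norm.const_mul _) ?_
  filter_upwards [ae_restrict_mem hΩ] with x hx
  have hw := growthWeight_pos U x
  have key : |B ε x - Real.exp (-U x) * polyFamily P (ε, x)| ≤
      (D₁ + (|C₃| + D₂)) * ε ^ N * (growthWeight U x ^ K₀)⁻¹ := by
    -- The expansion is used inside the region; outside, `B` and the polynomial are each small on
    -- their own.
    rcases le_or_gt (ε * growthWeight U x ^ 2) 1 with hr | hr
    · have h1 := hP x hx hr
      rw [Real.norm_of_nonneg (r := growthWeight U x ^ K₁ * ε ^ N) (by positivity)] at h1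
      have h2 : B ε x - Real.exp (-U x) * polyFamily P (ε, x) =
          Real.exp (-U x) * (B ε x * Real.exp (U x) - polyFamily P (ε, x)) := by
        rw [Real.exp_neg]
        have := (Real.exp_pos (U x)).ne'
        field_simp
      rw [h2, abs_mul, Real.abs_exp]
      calc _ ≤ Real.exp (-U x) * (C₁ * (growthWeight U x ^ K₁ * ε ^ N)) :=
            mul_le_mul_of_nonneg_left h1 (Real.exp_pos _).le
        _ = C₁ * ε ^ N * (Real.exp (-U x) * growthWeight U x ^ K₁) := by ring
        _ ≤ C₁ * ε ^ N * (((K₁ + K₀).factorial * Real.exp 1) * (growthWeight U x ^ K₀)⁻¹) :=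
            mul_le_mul_of_nonneg_left (exp_neg_mul_growthWeight_pow_le (hU x hx) K₁ K₀)
              (by positivity)
        _ = D₁ * ε ^ N * (growthWeight U x ^ K₀)⁻¹ := by rw [hD₁]; ring
        _ ≤ _ := by
            gcongr
            have := abs_nonneg C₃
            linarith
    · have h3 : (growthWeight U x ^ (K₀ + 2 * N))⁻¹ ≤ ε ^ N * (growthWeight U x ^ K₀)⁻¹ := by
        have h4 : 1 ≤ (ε * growthWeight U x ^ 2) ^ N := one_le_pow₀ hr.le
        rw [pow_add, mul_inv, mul_comm]
        gcongr
        rw [inv_le_iff_one_le_mul₀ (by positivity), pow_mul, ← mul_pow]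
        exact h4
      have h5 : |Real.exp (-U x) * polyFamily P (ε, x)| ≤
          D₂ * (growthWeight U x ^ (K₀ + 2 * N))⁻¹ := by
        rw [abs_mul, Real.abs_exp]
        calc _ ≤ Real.exp (-U x) * (C₂ * growthWeight U x ^ K₂) :=
              mul_le_mul_of_nonneg_left (hP2 ε h0 hε.2 x hx) (Real.exp_pos _).le
          _ = C₂ * (Real.exp (-U x) * growthWeight U x ^ K₂) := by ring
          _ ≤ C₂ * (((K₂ + (K₀ + 2 * N)).factorial * Real.exp 1) *
                (growthWeight U x ^ (K₀ + 2 * N))⁻¹) :=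
              mul_le_mul_of_nonneg_left (exp_neg_mul_growthWeight_pow_le (hU x hx) _ _) hC₂
          _ = _ := by rw [hD₂]; ring
      have h6 : |B ε x| ≤ |C₃| * (growthWeight U x ^ (K₀ + 2 * N))⁻¹ :=
        (hB x hx).trans (mul_le_mul_of_nonneg_right (le_abs_self _) (by positivity))
      calc _ ≤ |B ε x| + |Real.exp (-U x) * polyFamily P (ε, x)| := abs_sub _ _
        _ ≤ (|C₃| + D₂) * (growthWeight U x ^ (K₀ + 2 * N))⁻¹ := by
            rw [add_mul]; exact add_le_add h6 h5
        _ ≤ (|C₃| + D₂) * (ε ^ N * (growthWeight U x ^ K₀)⁻¹) := by gcongr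
        _ ≤ (D₁ + (|C₃| + D₂)) * (ε ^ N * (growthWeight U x ^ K₀)⁻¹) := by
            exact mul_le_mul_of_nonneg_right (by linarith) (by positivity)
        _ = _ := by ring
  rw [← mul_sub, norm_mul, norm_mul, Real.norm_of_nonneg (r := (growthWeight U x ^ K₀)⁻¹)
    (by positivity)]
  calc ‖ρ x‖ * |B ε x - Real.exp (-U x) * polyFamily P (ε, x)| ≤ ‖ρ x‖ * _ :=
        mul_le_mul_of_nonneg_left key (norm_nonneg _)
    _ = _ := by ring

end UniformExpansion

/-! ### Merging expansions of all orders. -/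

/-- Expansions to every order, with coefficients that may depend on the order, come from a single
sequence of coefficients. -/
theorem exists_coeff_of_forall_polynomial {I : ℝ → ℝ} {L : ℝ} (hL : Tendsto I (𝓝[>] 0) (𝓝 L))
    (h : ∀ N : ℕ, ∃ P : Polynomial ℝ,
      (fun ε => I ε - P.eval ε) =O[𝓝[>] (0 : ℝ)] fun ε => ε ^ N) :
    ∃ c : ℕ → ℝ, c 0 = L ∧ ∀ N : ℕ,
      (fun ε => I ε - ∑ j ∈ Finset.range N, c j * ε ^ j) =O[𝓝[>] (0 : ℝ)] fun ε => ε ^ N := by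
  choose P hP using h
  have hpow : ∀ {M N : ℕ}, M ≤ N →
      (fun ε : ℝ => ε ^ N) =O[𝓝[>] (0 : ℝ)] fun ε => ε ^ M := by
    intro M N hMN
    refine IsBigO.of_bound 1 ?_
    filter_upwards [Ioo_mem_nhdsGT (zero_lt_one' ℝ)] with ε hε
    have h0 : 0 < ε := hε.1
    rw [Real.norm_of_nonneg (by positivity), Real.norm_of_nonneg (by positivity), one_mul]
    exact pow_le_pow_of_le_one h0.le hε.2.le hMN
  have htrunc : ∀ {M N : ℕ}, M ≤ N →
      (fun ε => I ε - ∑ j ∈ Finset.range M, (P N).coeff j * ε ^ j)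
        =O[𝓝[>] (0 : ℝ)] fun ε => ε ^ M := by
    intro M N hMN
    have h1 : (fun ε : ℝ => ∑ i ∈ Finset.range ((P N).natDegree + 1),
        (P N).coeff (M + i) * ε ^ (M + i)) =O[𝓝[>] (0 : ℝ)] fun ε => ε ^ M :=
      IsBigO.fun_sum fun i _ => (hpow (Nat.le_add_right M i)).const_mul_left _
    refine (((hP N).trans (hpow hMN)).add h1).congr_left fun ε => ?_
    rw [Polynomial.eval_eq_sum_range' (n := M + ((P N).natDegree + 1)) (by omega),
      Finset.sum_range_add]
    ring
  -- A polynomial of degree below `N` that is `O(ε^N)` vanishes: let `ε → 0` to kill the constant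
  -- term, divide by `ε`, and induct.
  have huniq : ∀ N : ℕ, ∀ b : ℕ → ℝ, (fun ε => ∑ j ∈ Finset.range N, b j * ε ^ j)
      =O[𝓝[>] (0 : ℝ)] (fun ε => ε ^ N) → ∀ j < N, b j = 0 := by
    intro N
    induction N with
    | zero => intro b _ j hj; omega
    | succ N ih =>
      intro b hb
      have h0 : b 0 = 0 := by
        have ht : Tendsto (fun ε : ℝ => ∑ j ∈ Finset.range (N + 1), b j * ε ^ j) (𝓝[>] 0)
            (𝓝 (∑ j ∈ Finset.range (N + 1), b j * 0 ^ j)) :=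
          ((continuous_finsetSum _ fun j _ => continuous_const.mul
            (continuous_id.pow j)).tendsto 0).mono_left nhdsWithin_le_nhds
        have hz : Tendsto (fun ε : ℝ => ε ^ (N + 1)) (𝓝[>] 0) (𝓝 (0 ^ (N + 1))) :=
          ((continuous_id.pow (N + 1)).tendsto 0).mono_left nhdsWithin_le_nhds
        rw [zero_pow (Nat.succ_ne_zero N)] at hz
        have := tendsto_nhds_unique ht (hb.trans_tendsto hz)
        simpa [Finset.sum_range_succ'] using this
      have hdiv : (fun ε : ℝ => ∑ j ∈ Finset.range N, b (j + 1) * ε ^ j)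
          =O[𝓝[>] (0 : ℝ)] fun ε => ε ^ N := by
        refine (hb.mul (isBigO_refl (fun ε : ℝ => ε⁻¹) _)).congr' ?_ ?_
        · filter_upwards [self_mem_nhdsWithin] with ε hε
          have hε : ε ≠ 0 := (show (0 : ℝ) < ε from hε).ne'
          rw [Finset.sum_range_succ', h0, zero_mul, add_zero, Finset.sum_mul]
          refine Finset.sum_congr rfl fun j _ => ?_
          rw [pow_succ]
          field_simp
        · filter_upwards [self_mem_nhdsWithin] with ε hε
          have hε : ε ≠ 0 := (show (0 : ℝ) < ε from hε).ne'
          rw [pow_succ]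
          field_simp
      rintro (_ | j) hj
      · exact h0
      · exact ih _ hdiv j (by omega)
  -- Order `j + 1` is the first that determines the coefficient of `ε^j`.
  refine ⟨fun j => (P (j + 1)).coeff j, ?_, fun N => ?_⟩
  · have hz : Tendsto (fun ε : ℝ => ε ^ 1) (𝓝[>] 0) (𝓝 (0 ^ 1)) :=
      ((continuous_id.pow 1).tendsto 0).mono_left nhdsWithin_le_nhds
    rw [zero_pow one_ne_zero] at hz
    have h1 := (htrunc (le_refl 1)).trans_tendsto hz
    have h2 := hL.sub h1
    simp only [Finset.sum_range_one, pow_zero, mul_one, sub_sub_cancel, sub_zero] at h2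
    exact tendsto_nhds_unique tendsto_const_nhds h2
  · refine (htrunc (le_refl N)).congr_left fun ε => ?_
    congr 1
    refine Finset.sum_congr rfl fun j hj => ?_
    have hj := Finset.mem_range.1 hj
    have hd := (htrunc (le_refl (j + 1))).sub (htrunc (M := j + 1) (N := N) hj)
    have := huniq (j + 1) (fun i => (P N).coeff i - (P (j + 1)).coeff i)
      (hd.congr_left fun ε => by
        rw [sub_sub_sub_cancel_left, ← Finset.sum_sub_distrib]
        simp only [sub_mul]) j (Nat.lt_succ_self j)
    rw [sub_eq_zero.1 this]

/-! ### The rescaled integrand on the octant and its decay. -/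

/-- The positive octant, with coordinates `(τ, y₁, y₂)`. -/
def posOctant : Set (ℝ × ℝ × ℝ) := Ioi 0 ×ˢ (Ioi 0 ×ˢ Ioi 0)

/-- The limiting phase `y₁ + y₂ + τ/y₁ + τ/y₂`. -/
noncomputable def limitPhase (x : ℝ × ℝ × ℝ) : ℝ :=
  x.2.1 + x.2.2 + x.1 / x.2.1 + x.1 / x.2.2

/-- The density `τ ^ s (y₁ y₂) ^ (m - 1)`. -/
noncomputable def octantDensity (m s : ℝ) (x : ℝ × ℝ × ℝ) : ℝ :=
  x.1 ^ s * (x.2.1 ^ (m - 1) * x.2.2 ^ (m - 1))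

/-- The rescaled kernel `(1 + ε y / q) ^ (-(q / ε + m)) (1 + ε τ / (p y)) ^ (-p / ε)` of Euler's
integral. -/
noncomputable def eulerKernel (m p q ε τ y : ℝ) : ℝ :=
  (1 + ε * (y / q)) ^ (-(q / ε + m)) * (1 + ε * (τ / y / p)) ^ (-(p / ε))

/-- The rescaled power `t ^ (p / ε + q / ε + m - 1)`, where `t = (1 - ε² τ / (p q))₊`. -/
noncomputable def rescaledPower (m p q ε τ : ℝ) : ℝ :=
  (max (1 - ε * (ε * τ / (p * q))) 0) ^ (p / ε + q / ε + m - 1)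

/-- The integrand, in rescaled coordinates, of `weightedCoeff`. -/
noncomputable def rescaledIntegrand (n : ℕ) (p q ε : ℝ) (x : ℝ × ℝ × ℝ) : ℝ :=
  (∏ k ∈ Finset.range n, (1 + ε * (k / q))) ^ 2 * (rescaledPower n p q ε x.1 *
    (eulerKernel n p q ε x.1 x.2.1 * eulerKernel n p q ε x.1 x.2.2))

theorem measurableSet_posOctant : MeasurableSet posOctant :=
  measurableSet_Ioi.prod (measurableSet_Ioi.prod measurableSet_Ioi)

theorem measurable_limitPhase : Measurable limitPhase := by
  unfold limitPhase; fun_prop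

theorem measurable_octantDensity (m s : ℝ) : Measurable (octantDensity m s) := by
  unfold octantDensity; fun_prop

theorem measurable_rescaledIntegrand (n : ℕ) (p q ε : ℝ) :
    Measurable (rescaledIntegrand n p q ε) := by
  unfold rescaledIntegrand rescaledPower eulerKernel; fun_prop

theorem limitPhase_terms_nonneg {x : ℝ × ℝ × ℝ} (hx : x ∈ posOctant) :
    0 < x.1 ∧ 0 < x.2.1 ∧ 0 < x.2.2 ∧ 0 < x.1 / x.2.1 ∧ 0 < x.1 / x.2.2 := by
  obtain ⟨h1, h2, h3⟩ := hx
  have h1 : 0 < x.1 := h1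
  have h2 : 0 < x.2.1 := h2
  have h3 : 0 < x.2.2 := h3
  exact ⟨h1, h2, h3, div_pos h1 h2, div_pos h1 h3⟩

theorem limitPhase_nonneg {x : ℝ × ℝ × ℝ} (hx : x ∈ posOctant) : 0 ≤ limitPhase x := by
  obtain ⟨-, h2, h3, h4, h5⟩ := limitPhase_terms_nonneg hx
  unfold limitPhase
  positivity

theorem growthWeight_limitPhase {x : ℝ × ℝ × ℝ} (hx : x ∈ posOctant) :
    growthWeight limitPhase x = 1 + (x.2.1 + x.2.2 + x.1 / x.2.1 + x.1 / x.2.2) := by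
  rw [growthWeight, abs_of_nonneg (limitPhase_nonneg hx), limitPhase]

/-- The phase controls `τ` only quadratically, through `τ = y₁ · (τ/y₁)`. -/
theorem one_add_le_growthWeight_sq {x : ℝ × ℝ × ℝ} (hx : x ∈ posOctant) :
    1 + x.1 ≤ growthWeight limitPhase x ^ 2 := by
  obtain ⟨h1, h2, h3, h4, h5⟩ := limitPhase_terms_nonneg hx
  rw [growthWeight_limitPhase hx]
  have : x.1 = x.2.1 * (x.1 / x.2.1) := by field_simp
  nlinarith [mul_pos h2 h4]

theorem mem_temperedFunctions_of_le {f : ℝ × ℝ × ℝ → ℝ} (hf : Measurable f) (K : ℕ)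
    (h : ∀ x ∈ posOctant, 0 ≤ f x ∧ f x ≤ growthWeight limitPhase x ^ K) :
    f ∈ temperedFunctions limitPhase posOctant :=
  ⟨hf, 1, K, fun x hx => by rw [abs_of_nonneg (h x hx).1, one_mul]; exact (h x hx).2⟩

/-- Bernoulli's inequality with exponent `a / (ε (K+1)) ≥ 1` gives the lower bound `1 + u/(K+1) ≥
(1+u)/(K+1)`; then raise it to the power `K + 1`. The constant is independent of `ε`. -/
theorem one_add_mul_rpow_neg_le {a ε u : ℝ} (K : ℕ) (ha : 0 < a) (hε : 0 < ε) (hu : 0 ≤ u)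
    (hK : ε * (K + 1) ≤ a) :
    (1 + ε * (u / a)) ^ (-(a / ε)) ≤ (K + 1 : ℝ) ^ (K + 1) * ((1 + u) ^ K)⁻¹ := by
  have hK0 : (0 : ℝ) < K + 1 := by positivity
  have hr : 1 ≤ a / (ε * (K + 1)) := by rwa [one_le_div (by positivity)]
  have hb : 0 < 1 + ε * (u / a) := by positivity
  have h1 := one_add_mul_self_le_rpow_one_add (s := ε * (u / a))
    (by have : 0 ≤ ε * (u / a) := by positivity
        linarith) hr
  have h2 : (1 + u) / (K + 1) ≤ (1 + ε * (u / a)) ^ (a / (ε * (K + 1))) := by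
    refine le_trans ?_ h1
    rw [div_le_iff₀ hK0]
    field_simp
    have : (0 : ℝ) ≤ K := K.cast_nonneg
    linarith
  have h3 : ((1 + u) / (K + 1)) ^ (K + 1) ≤ (1 + ε * (u / a)) ^ (a / ε) := by
    calc _ ≤ ((1 + ε * (u / a)) ^ (a / (ε * (K + 1)))) ^ (K + 1) := by gcongr
      _ = _ := by
        rw [← Real.rpow_natCast, ← Real.rpow_mul hb.le]
        congr 1
        push_cast
        field_simp
  rw [Real.rpow_neg hb.le, inv_le_comm₀ (by positivity) (by positivity)]
  refine le_trans ?_ h3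
  rw [mul_inv, inv_inv, div_pow, div_eq_inv_mul]
  gcongr
  · linarith
  · exact Nat.le_succ K

theorem eulerKernel_nonneg {m p q ε τ y : ℝ} (hp : 0 < p) (hq : 0 < q) (hε : 0 < ε)
    (hτ : 0 < τ) (hy : 0 < y) : 0 ≤ eulerKernel m p q ε τ y := by
  unfold eulerKernel
  positivity

theorem eulerKernel_le {m p q ε τ y : ℝ} (K : ℕ) (hm : 0 ≤ m) (hp : 0 < p) (hq : 0 < q)
    (hε : 0 < ε) (hτ : 0 < τ) (hy : 0 < y) (hpK : ε * (K + 1) ≤ p) (hqK : ε * (K + 1) ≤ q) :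
    eulerKernel m p q ε τ y ≤
      (((K + 1 : ℝ) ^ (K + 1)) ^ 2) * (((1 + y) * (1 + τ / y)) ^ K)⁻¹ := by
  have h1 : (1 + ε * (y / q)) ^ (-(q / ε + m)) ≤ (1 + ε * (y / q)) ^ (-(q / ε)) := by
    refine Real.rpow_le_rpow_of_exponent_le ?_ (by linarith)
    have : 0 ≤ ε * (y / q) := by positivity
    linarith
  have h2 := one_add_mul_rpow_neg_le K hq hε hy.le hqK
  have h3 := one_add_mul_rpow_neg_le K hp hε (div_pos hτ hy).le hpK
  calc _ ≤ ((K + 1 : ℝ) ^ (K + 1) * ((1 + y) ^ K)⁻¹) *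
        ((K + 1 : ℝ) ^ (K + 1) * ((1 + τ / y) ^ K)⁻¹) :=
        mul_le_mul (h1.trans h2) h3 (by positivity) (by positivity)
    _ = _ := by rw [mul_pow, mul_inv]; ring

theorem rescaledPower_mem_Icc {n : ℕ} (hn : 1 ≤ n) {p q ε τ : ℝ} (hp : 0 < p) (hq : 0 < q)
    (hε : 0 < ε) (hτ : 0 < τ) : rescaledPower n p q ε τ ∈ Icc 0 1 := by
  have h1 : (1 : ℝ) ≤ n := by exact_mod_cast hn
  have h2 : 0 < p / ε := by positivity
  have h3 : 0 < q / ε := by positivity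
  refine ⟨Real.rpow_nonneg (le_max_right _ _) _, Real.rpow_le_one (le_max_right _ _) ?_ ?_⟩
  · refine max_le ?_ zero_le_one
    have : 0 ≤ ε * (ε * τ / (p * q)) := by positivity
    linarith
  · linarith

theorem rescaledIntegrand_decay {n : ℕ} (hn : 1 ≤ n) {p q : ℝ} (hp : 0 < p) (hq : 0 < q)
    (K : ℕ) : ∃ C : ℝ, ∀ᶠ ε in 𝓝[>] (0 : ℝ), ∀ x ∈ posOctant,
      |rescaledIntegrand n p q ε x| ≤ C * (growthWeight limitPhase x ^ K)⁻¹ := by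
  refine ⟨(∏ k ∈ Finset.range n, (1 + (k / q))) ^ 2 * (((K + 1 : ℝ) ^ (K + 1)) ^ 2) ^ 2, ?_⟩
  have hK : (0 : ℝ) < K + 1 := by positivity
  filter_upwards [Ioo_mem_nhdsGT (zero_lt_one' ℝ), Ioo_mem_nhdsGT (div_pos hp hK),
    Ioo_mem_nhdsGT (div_pos hq hK)] with ε hε hεp hεq x hx
  have h0 : 0 < ε := hε.1
  have hpK := ((lt_div_iff₀ hK).1 hεp.2).le
  have hqK := ((lt_div_iff₀ hK).1 hεq.2).le
  obtain ⟨h1, h2, h3, h4, h5⟩ := limitPhase_terms_nonneg hx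
  have hw := growthWeight_pos limitPhase x
  have hcut := rescaledPower_mem_Icc hn hp hq h0 h1
  have e1 := eulerKernel_nonneg (m := n) hp hq h0 h1 h2
  have e2 := eulerKernel_nonneg (m := n) hp hq h0 h1 h3
  have l1 := eulerKernel_le K (Nat.cast_nonneg n) hp hq h0 h1 h2 hpK hqK
  have l2 := eulerKernel_le K (Nat.cast_nonneg n) hp hq h0 h1 h3 hpK hqK
  have hprod : ∏ k ∈ Finset.range n, (1 + ε * ((k : ℝ) / q)) ≤
      ∏ k ∈ Finset.range n, (1 + ((k : ℝ) / q)) := by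
    refine Finset.prod_le_prod (fun k _ => by positivity) fun k _ => ?_
    have : (0 : ℝ) ≤ k / q := by positivity
    nlinarith [hε.2]
  have hprod0 : 0 ≤ ∏ k ∈ Finset.range n, (1 + ε * ((k : ℝ) / q)) :=
    Finset.prod_nonneg fun k _ => by positivity
  have hprod1 : 0 ≤ ∏ k ∈ Finset.range n, (1 + ((k : ℝ) / q)) :=
    Finset.prod_nonneg fun k _ => by positivity
  -- Expanding the product of the four factors yields every term of the weight, so the bounds for
  -- the two kernels combine into decay in the weight.
  have hW : growthWeight limitPhase x ≤
      ((1 + x.2.1) * (1 + x.1 / x.2.1)) * ((1 + x.2.2) * (1 + x.1 / x.2.2)) := by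
    rw [growthWeight_limitPhase hx]
    have a := mul_pos h2 h4
    have b := mul_pos h3 h5
    nlinarith [mul_pos a b, mul_pos (add_pos (add_pos h2 h4) a) (add_pos (add_pos h3 h5) b)]
  rw [rescaledIntegrand, abs_of_nonneg (by have := hcut.1; positivity)]
  calc _ ≤ (∏ k ∈ Finset.range n, (1 + ((k : ℝ) / q))) ^ 2 *
        (1 * (((((K + 1 : ℝ) ^ (K + 1)) ^ 2) * (((1 + x.2.1) * (1 + x.1 / x.2.1)) ^ K)⁻¹) *
        ((((K + 1 : ℝ) ^ (K + 1)) ^ 2) * (((1 + x.2.2) * (1 + x.1 / x.2.2)) ^ K)⁻¹))) := by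
        have := hcut.1
        have := hcut.2
        gcongr
    _ = (∏ k ∈ Finset.range n, (1 + ((k : ℝ) / q))) ^ 2 * (((K + 1 : ℝ) ^ (K + 1)) ^ 2) ^ 2 *
        ((((1 + x.2.1) * (1 + x.1 / x.2.1)) * ((1 + x.2.2) * (1 + x.1 / x.2.2))) ^ K)⁻¹ := by
        rw [mul_pow ((1 + x.2.1) * (1 + x.1 / x.2.1)), mul_inv]; ring
    _ ≤ _ := by gcongr

theorem integrableOn_octantDensity (m s : ℝ) (hm : 0 < m) (hs : -1 < s) :
    ∃ K : ℕ, IntegrableOn (fun x => octantDensity m s x * (growthWeight limitPhase x ^ K)⁻¹)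
      posOctant := by
  obtain ⟨M, hM⟩ := exists_nat_gt (max m (s + 1))
  have hMm := (le_max_left _ _).trans_lt hM
  have hMs := (le_max_right _ _).trans_lt hM
  have hone : ∀ {a : ℝ}, 0 < a → a < M →
      Integrable (fun w : ℝ => w ^ (a - 1) * (1 + w) ^ (-(M : ℝ))) (volume.restrict (Ioi 0)) := by
    intro a ha haM
    have := integrableOn_rpow_mul_one_add_rpow ha (sub_pos.2 haM)
    rwa [add_sub_cancel] at this
  have hI := (hone (by linarith : 0 < s + 1) hMs).mul_prod ((hone hm hMm).mul_prod (hone hm hMm))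
  rw [Measure.prod_restrict, Measure.prod_restrict] at hI
  -- `2 M` powers of the weight pay for `(1+τ)^M`, and `M` for each of `(1+y₁)^M` and `(1+y₂)^M`;
  -- the choice of `M` makes the three resulting Beta integrals converge.
  refine ⟨4 * M, Integrable.mono' hI ?_ ?_⟩
  · refine ((measurable_octantDensity m s).mul ?_).aestronglyMeasurable
    have := measurable_limitPhase
    unfold growthWeight
    fun_prop
  · filter_upwards [ae_restrict_mem measurableSet_posOctant] with x hx
    obtain ⟨h1, h2, h3, h4, h5⟩ := limitPhase_terms_nonneg hx
    have hw := growthWeight_pos limitPhase x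
    have hd : 0 ≤ octantDensity m s x := by unfold octantDensity; positivity
    rw [Real.norm_of_nonneg (by positivity), Real.rpow_neg (by linarith),
      Real.rpow_neg (by linarith), Real.rpow_neg (by linarith), Real.rpow_natCast,
      Real.rpow_natCast, Real.rpow_natCast, octantDensity, add_sub_cancel_right]
    have k1 := one_add_le_growthWeight_sq hx
    have k2 : 1 + x.2.1 ≤ growthWeight limitPhase x := by
      rw [growthWeight_limitPhase hx]; linarith
    have k3 : 1 + x.2.2 ≤ growthWeight limitPhase x := by
      rw [growthWeight_limitPhase hx]; linarith
    have k4 : (1 + x.1) ^ M * ((1 + x.2.1) ^ M * (1 + x.2.2) ^ M) ≤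
        growthWeight limitPhase x ^ (4 * M) := by
      calc _ ≤ (growthWeight limitPhase x ^ 2) ^ M *
            (growthWeight limitPhase x ^ M * growthWeight limitPhase x ^ M) := by gcongr
        _ = _ := by rw [← pow_mul, ← pow_add, ← pow_add]; congr 1; ring
    calc _ ≤ x.1 ^ s * (x.2.1 ^ (m - 1) * x.2.2 ^ (m - 1)) *
          ((1 + x.1) ^ M * ((1 + x.2.1) ^ M * (1 + x.2.2) ^ M))⁻¹ := by gcongr
      _ = _ := by rw [mul_inv, mul_inv]; ring

/-! ### Expansion of the rescaled integrand. -/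

theorem IsRemainder.mul_sub_one {X : Type*} {U : X → ℝ} {Ω : Set X} {F G : ℝ × X → ℝ}
    (hF : IsRemainder U Ω 1 fun z => F z - 1) (hG : IsRemainder U Ω 1 fun z => G z - 1) :
    IsRemainder U Ω 1 fun z => F z * G z - 1 :=
  ((((hF.mul hG).mono one_le_two).add hF).add hG).congr
    (Eventually.of_forall fun z => by simp only; ring)

/-- The difference of the exact and the limiting exponents of `rescaledIntegrand`. -/
noncomputable def phaseDefect (m p q : ℝ) (z : ℝ × ℝ × ℝ × ℝ) : ℝ :=
  -q * (Real.log (1 + z.1 * (z.2.2.1 / q)) / z.1 - z.2.2.1 / q) +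
  -q * (Real.log (1 + z.1 * (z.2.2.2 / q)) / z.1 - z.2.2.2 / q) +
  -p * (Real.log (1 + z.1 * (z.2.1 / z.2.2.1 / p)) / z.1 - z.2.1 / z.2.2.1 / p) +
  -p * (Real.log (1 + z.1 * (z.2.1 / z.2.2.2 / p)) / z.1 - z.2.1 / z.2.2.2 / p) +
  -m * (z.1 * (Real.log (1 + z.1 * (z.2.2.1 / q)) / z.1)) +
  -m * (z.1 * (Real.log (1 + z.1 * (z.2.2.2 / q)) / z.1)) +
  (p + q) * (Real.log (1 + z.1 * (-(p * q)⁻¹ * (z.1 * z.2.1))) / z.1) +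
  (m - 1) * (z.1 * (Real.log (1 + z.1 * (-(p * q)⁻¹ * (z.1 * z.2.1))) / z.1))

section phase

variable {X : Type*} {U : X → ℝ} {Ω : Set X} {F : ℝ × X → ℝ} {C : ℝ}

theorem isBigO_param_mul_log_div
    (hC : ∀ᶠ z in smallParamFilter U Ω, |F z| ≤ C * growthWeight U z.2) :
    (fun z => z.1 * (Real.log (1 + z.1 * F z) / z.1)) =O[smallParamFilter U Ω]
      fun z => growthWeight U z.2 ^ 2 * z.1 := by
  have h1 : F =O[smallParamFilter U Ω] fun z => growthWeight U z.2 ^ 2 := by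
    refine IsBigO.of_bound C ?_
    filter_upwards [hC] with z hz
    have hw := one_le_growthWeight U z.2
    have hC0 : 0 ≤ C := nonneg_of_mul_nonneg_left ((abs_nonneg _).trans hz)
      (growthWeight_pos U z.2)
    rw [Real.norm_of_nonneg (r := growthWeight U z.2 ^ 2) (by positivity)]
    exact hz.trans (mul_le_mul_of_nonneg_left (by nlinarith) hC0)
  have h2 : (fun z : ℝ × X => growthWeight U z.2 ^ 2 * z.1) =O[smallParamFilter U Ω]
      fun z => growthWeight U z.2 ^ 2 := by
    simpa using isBigO_growthWeight_pow (U := U) (Ω := Ω) (le_refl 2) (Nat.zero_le 1)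
  have h3 := ((isBigO_log_div_sub hC).trans h2).add h1
  refine ((isBigO_refl (fun z : ℝ × X => z.1) _).mul h3).congr (fun z => ?_) fun z => ?_
  · ring
  · ring

end phase

section expansion

variable {m p q : ℝ}

theorem eventually_div_le {a : ℝ} (ha : 0 < a) {f : ℝ × ℝ × ℝ → ℝ}
    (hf : ∀ x ∈ posOctant, 0 ≤ f x ∧ f x ≤ growthWeight limitPhase x) :
    ∀ᶠ z in smallParamFilter limitPhase posOctant,
      |f z.2 / a| ≤ a⁻¹ * growthWeight limitPhase z.2 := by
  filter_upwards [eventually_pos_smallParamFilter] with z hz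
  have := hf z.2 hz.2.2.1
  rw [abs_of_nonneg (div_nonneg this.1 ha.le), div_eq_inv_mul]
  exact mul_le_mul_of_nonneg_left this.2 (inv_nonneg.2 ha.le)

theorem hasUniformExpansion_div {a : ℝ} {f : ℝ × ℝ × ℝ → ℝ} (hm : Measurable f)
    (hf : ∀ x ∈ posOctant, 0 ≤ f x ∧ f x ≤ growthWeight limitPhase x) (N : ℕ) :
    HasUniformExpansion limitPhase posOctant N fun z => f z.2 / a := by
  have := (HasUniformExpansion.tempered (N := N) (mem_temperedFunctions_of_le hm 1 fun x hx => by
    rw [pow_one]; exact hf x hx)).const_mul a⁻¹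
  simpa only [div_eq_inv_mul] using this

theorem y₁_bounds {x : ℝ × ℝ × ℝ} (hx : x ∈ posOctant) :
    0 ≤ x.2.1 ∧ x.2.1 ≤ growthWeight limitPhase x := by
  obtain ⟨h1, h2, h3, h4, h5⟩ := limitPhase_terms_nonneg hx
  rw [growthWeight_limitPhase hx]
  constructor <;> linarith

theorem y₂_bounds {x : ℝ × ℝ × ℝ} (hx : x ∈ posOctant) :
    0 ≤ x.2.2 ∧ x.2.2 ≤ growthWeight limitPhase x := by
  obtain ⟨h1, h2, h3, h4, h5⟩ := limitPhase_terms_nonneg hx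
  rw [growthWeight_limitPhase hx]
  constructor <;> linarith

theorem τ_div_y₁_bounds {x : ℝ × ℝ × ℝ} (hx : x ∈ posOctant) :
    0 ≤ x.1 / x.2.1 ∧ x.1 / x.2.1 ≤ growthWeight limitPhase x := by
  obtain ⟨h1, h2, h3, h4, h5⟩ := limitPhase_terms_nonneg hx
  rw [growthWeight_limitPhase hx]
  constructor <;> linarith

theorem τ_div_y₂_bounds {x : ℝ × ℝ × ℝ} (hx : x ∈ posOctant) :
    0 ≤ x.1 / x.2.2 ∧ x.1 / x.2.2 ≤ growthWeight limitPhase x := by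
  obtain ⟨h1, h2, h3, h4, h5⟩ := limitPhase_terms_nonneg hx
  rw [growthWeight_limitPhase hx]
  constructor <;> linarith

theorem isBigO_param_mul_τ (c : ℝ) :
    (fun z : ℝ × ℝ × ℝ × ℝ => c * (z.1 * z.2.1)) =O[smallParamFilter limitPhase posOctant]
      fun z => growthWeight limitPhase z.2 ^ 2 * z.1 := by
  refine IsBigO.const_mul_left (IsBigO.of_bound 1 ?_) c
  filter_upwards [eventually_pos_smallParamFilter] with z hz
  have h0 := hz.1
  have h1 := (limitPhase_terms_nonneg hz.2.2.1).1
  have := one_add_le_growthWeight_sq hz.2.2.1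
  rw [Real.norm_of_nonneg (by positivity), Real.norm_of_nonneg (by positivity), one_mul, mul_comm]
  gcongr
  linarith

/-- The logarithm lemmas require linear growth, while `τ` is quadratic in the weight; the spare
factor `ε` repairs this, since `ε τ ≤ ε (1+U)² ≤ 1`. -/
theorem eventually_param_mul_τ_le (c : ℝ) :
    ∀ᶠ z : ℝ × ℝ × ℝ × ℝ in smallParamFilter limitPhase posOctant,
      |c * (z.1 * z.2.1)| ≤ |c| * growthWeight limitPhase z.2 := by
  filter_upwards [eventually_pos_smallParamFilter] with z hz
  have h0 := hz.1
  have h1 := (limitPhase_terms_nonneg hz.2.2.1).1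
  have h2 := one_add_le_growthWeight_sq hz.2.2.1
  have h3 := one_le_growthWeight limitPhase z.2
  rw [abs_mul, abs_of_pos (a := z.1 * z.2.1) (by positivity)]
  refine mul_le_mul_of_nonneg_left (le_trans ?_ h3) (abs_nonneg c)
  refine le_trans ?_ hz.2.2.2
  gcongr
  linarith

theorem isBigO_phaseDefect (hp : 0 < p) (hq : 0 < q) :
    phaseDefect m p q =O[smallParamFilter limitPhase posOctant]
      fun z => growthWeight limitPhase z.2 ^ 2 * z.1 := by
  have a1 := eventually_div_le hq fun x hx => y₁_bounds hx
  have a2 := eventually_div_le hq fun x hx => y₂_bounds hx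
  have a3 := eventually_div_le hp fun x hx => τ_div_y₁_bounds hx
  have a4 := eventually_div_le hp fun x hx => τ_div_y₂_bounds hx
  have a5 := eventually_param_mul_τ_le (-(p * q)⁻¹)
  refine IsBigO.add (IsBigO.add (IsBigO.add (IsBigO.add (IsBigO.add (IsBigO.add (IsBigO.add
    ?_ ?_) ?_) ?_) ?_) ?_) ?_) ?_
  · exact (isBigO_log_div_sub a1).const_mul_left _
  · exact (isBigO_log_div_sub a2).const_mul_left _
  · exact (isBigO_log_div_sub a3).const_mul_left _
  · exact (isBigO_log_div_sub a4).const_mul_left _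
  · exact (isBigO_param_mul_log_div a1).const_mul_left _
  · exact (isBigO_param_mul_log_div a2).const_mul_left _
  -- No limiting term is subtracted here: the argument `-(p q)⁻¹ ε τ` already carries a factor `ε`,
  -- so this contribution vanishes in the limit.
  · refine IsBigO.const_mul_left ?_ _
    exact ((isBigO_log_div_sub a5).add (isBigO_param_mul_τ (-(p * q)⁻¹))).congr_left
      fun z => by ring
  · exact (isBigO_param_mul_log_div a5).const_mul_left _

theorem hasUniformExpansion_phaseDefect (hp : 0 < p) (hq : 0 < q) (N : ℕ) :
    HasUniformExpansion limitPhase posOctant N (phaseDefect m p q) := by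
  have b1 := hasUniformExpansion_div (a := q) (by fun_prop) (fun x hx => y₁_bounds hx) N
  have b2 := hasUniformExpansion_div (a := q) (by fun_prop) (fun x hx => y₂_bounds hx) N
  have b3 := hasUniformExpansion_div (a := p) (by fun_prop) (fun x hx => τ_div_y₁_bounds hx) N
  have b4 := hasUniformExpansion_div (a := p) (by fun_prop) (fun x hx => τ_div_y₂_bounds hx) N
  have b5 : HasUniformExpansion limitPhase posOctant N
      fun z => -(p * q)⁻¹ * (z.1 * z.2.1) :=
    (HasUniformExpansion.param.mul (HasUniformExpansion.tempered
      (mem_temperedFunctions_of_le measurable_fst 2 fun x hx =>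
        ⟨(limitPhase_terms_nonneg hx).1.le, by
          linarith [one_add_le_growthWeight_sq hx]⟩))).const_mul _
  have c1 := b1.log (eventually_div_le hq fun x hx => y₁_bounds hx)
  have c2 := b2.log (eventually_div_le hq fun x hx => y₂_bounds hx)
  have c3 := b3.log (eventually_div_le hp fun x hx => τ_div_y₁_bounds hx)
  have c4 := b4.log (eventually_div_le hp fun x hx => τ_div_y₂_bounds hx)
  have c5 := b5.log (eventually_param_mul_τ_le _)
  have hsub : ∀ {F G : ℝ × ℝ × ℝ × ℝ → ℝ}, HasUniformExpansion limitPhase posOctant N F →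
      HasUniformExpansion limitPhase posOctant N G →
      HasUniformExpansion limitPhase posOctant N fun z => F z - G z := fun hF hG => by
    simpa only [sub_eq_add_neg, neg_one_mul] using hF.add (hG.const_mul (-1))
  exact (((((((((hsub c1 b1).const_mul _).add ((hsub c2 b2).const_mul _)).add
    ((hsub c3 b3).const_mul _)).add ((hsub c4 b4).const_mul _)).add
    ((HasUniformExpansion.param.mul c1).const_mul _)).add
    ((HasUniformExpansion.param.mul c2).const_mul _)).add (c5.const_mul _)).add
    ((HasUniformExpansion.param.mul c5).const_mul _))

/-- On the region the base of `rescaledPower` is positive, so the cutoff at `0` is inactive and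
every real power is the exponential of a logarithm. -/
theorem rescaledIntegrand_mul_exp (n : ℕ) (hp : 0 < p) (hq : 0 < q) :
    (fun z : ℝ × ℝ × ℝ × ℝ => (∏ k ∈ Finset.range n, (1 + z.1 * ((k : ℝ) / q))) ^ 2 *
      Real.exp (phaseDefect n p q z)) =ᶠ[smallParamFilter limitPhase posOctant]
      fun z => rescaledIntegrand n p q z.1 z.2 * Real.exp (limitPhase z.2) := by
  filter_upwards [eventually_pos_smallParamFilter,
    eventually_log_bounds (eventually_param_mul_τ_le (-(p * q)⁻¹))] with z ⟨h0, _, hx, _⟩ hcut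
  obtain ⟨h1, h2, h3, h4, h5⟩ := limitPhase_terms_nonneg hx
  have hc : 0 < 1 + z.1 * (-(p * q)⁻¹ * (z.1 * z.2.1)) := by
    linarith [(abs_le.1 hcut.1).1]
  have hc' : 1 - z.1 * (z.1 * z.2.1 / (p * q)) = 1 + z.1 * (-(p * q)⁻¹ * (z.1 * z.2.1)) := by
    ring
  rw [rescaledIntegrand, mul_assoc]
  congr 1
  unfold rescaledPower eulerKernel
  rw [hc', max_eq_left hc.le, Real.rpow_def_of_pos hc, Real.rpow_def_of_pos (by positivity),
    Real.rpow_def_of_pos (by positivity), Real.rpow_def_of_pos (by positivity),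
    Real.rpow_def_of_pos (by positivity), ← Real.exp_add, ← Real.exp_add, ← Real.exp_add,
    ← Real.exp_add, ← Real.exp_add]
  congr 1
  unfold phaseDefect limitPhase
  field_simp
  ring

theorem hasUniformExpansion_rescaledIntegrand (n : ℕ) (hp : 0 < p) (hq : 0 < q) (N : ℕ) :
    HasUniformExpansion limitPhase posOctant N
      fun z => rescaledIntegrand n p q z.1 z.2 * Real.exp (limitPhase z.2) := by
  refine HasUniformExpansion.congr ?_ (rescaledIntegrand_mul_exp n hp hq)
  refine HasUniformExpansion.mul (HasUniformExpansion.pow (HasUniformExpansion.prod _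
    fun k _ => ?_) 2) ((hasUniformExpansion_phaseDefect hp hq N).exp (isBigO_phaseDefect hp hq))
  exact (HasUniformExpansion.const 1).add
    (HasUniformExpansion.param.mul (HasUniformExpansion.const _))

/-- The general expansion does not identify its constant coefficient; this order-one statement does,
with value `1`. -/
theorem isRemainder_rescaledIntegrand (n : ℕ) (hp : 0 < p) (hq : 0 < q) :
    IsRemainder limitPhase posOctant 1
      fun z => rescaledIntegrand n p q z.1 z.2 * Real.exp (limitPhase z.2) - 1 := by
  have hexp := isRemainder_exp_sub_sum (isBigO_phaseDefect (m := n) hp hq) 1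
  simp only [Finset.sum_range_one, pow_zero, mul_one, Nat.factorial_zero, Nat.cast_one,
    inv_one] at hexp
  have hprod : ∀ M : ℕ, IsRemainder limitPhase posOctant 1
      fun z => ∏ k ∈ Finset.range M, (1 + z.1 * ((k : ℝ) / q)) - 1 := by
    intro M
    induction M with
    | zero => simpa using isRemainder_zero 1
    | succ M ih =>
      simp only [Finset.prod_range_succ]
      refine ih.mul_sub_one ⟨0, ?_⟩
      refine ((isBigO_refl (fun z : ℝ × ℝ × ℝ × ℝ => z.1) _).const_mul_left ((M : ℝ) / q)).congr
        (fun z => ?_) fun z => ?_ <;> ring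
  refine (((hprod n).mul_sub_one (hprod n)).mul_sub_one hexp).congr ?_
  filter_upwards [rescaledIntegrand_mul_exp n hp hq] with z hz
  rw [← hz, sq]

end expansion

/-! ### Expansion of the octant integral and its leading term. -/

/-- The limiting integral. -/
noncomputable def leadingIntegral (m s : ℝ) : ℝ :=
  ∫ x in posOctant, octantDensity m s x * Real.exp (-limitPhase x)

theorem exists_coeff_rescaledIntegrand {n : ℕ} (hn : 1 ≤ n) {s p q : ℝ} (hs : -1 < s)
    (hp : 0 < p) (hq : 0 < q) :
    ∃ c : ℕ → ℝ, c 0 = leadingIntegral n s ∧ ∀ N : ℕ,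
      (fun ε => (∫ x in posOctant, octantDensity n s x * rescaledIntegrand n p q ε x) -
        ∑ j ∈ Finset.range N, c j * ε ^ j) =O[𝓝[>] (0 : ℝ)] fun ε => ε ^ N := by
  obtain ⟨K, hK⟩ := integrableOn_octantDensity n s (by exact_mod_cast hn) hs
  have hmain := fun (N : ℕ) (P : Polynomial (temperedFunctions limitPhase posOctant)) =>
    isBigO_integral_sub_sum (N := N) measurableSet_posOctant measurable_limitPhase
    (fun x hx => limitPhase_nonneg hx) (measurable_octantDensity n s) hK
    (measurable_rescaledIntegrand n p q) (rescaledIntegrand_decay hn hp hq) P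
  refine exists_coeff_of_forall_polynomial ?_ fun N => ?_
  -- Order one with the constant polynomial `1`: the octant integral tends to `leadingIntegral`.
  · have h1 := hmain 1 1 (by simpa [polyFamily] using isRemainder_rescaledIntegrand n hp hq)
    have hz : Tendsto (fun ε : ℝ => ε ^ 1) (𝓝[>] 0) (𝓝 (0 ^ 1)) :=
      ((continuous_id.pow 1).tendsto 0).mono_left nhdsWithin_le_nhds
    rw [zero_pow one_ne_zero] at hz
    have h2 := (h1.trans_tendsto hz).add_const (leadingIntegral n s)
    simpa [leadingIntegral] using h2
  · obtain ⟨P, hP⟩ := hasUniformExpansion_rescaledIntegrand n hp hq N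
    refine ⟨∑ j ∈ Finset.range (P.natDegree + 1), Polynomial.C (∫ x in posOctant,
      octantDensity n s x * (Real.exp (-limitPhase x) * (P.coeff j).1 x)) * Polynomial.X ^ j, ?_⟩
    refine (hmain N P hP).congr_left fun ε => ?_
    rw [Polynomial.eval_finsetSum]
    simp

/-- The `τ`-integral is `Γ(s+1) (y₁ y₂ / (y₁+y₂))^(s+1)`. Rewriting `Γ(s+1) (y₁+y₂)^(-s-1)` as the
integral of `w^s exp(-(y₁+y₂)w)` decouples `y₁` from `y₂`; each then gives `Γ(m+s+1)
(1+w)^(-(m+s+1))`, leaving a Beta integral with parameters `s+1` and `2m+s+1`. -/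
theorem leadingIntegral_eq {m s : ℝ} (hm : 0 < m) (hs : -1 < s) :
    leadingIntegral m s = Real.Gamma (2 * m + s + 1) * Real.Gamma (m + s + 1) ^ 2 *
      Real.Gamma (s + 1) / Real.Gamma (2 * m + 2 * s + 2) := by
  have hs1 : 0 < s + 1 := by linarith
  have ha : 0 < m + s + 1 := by linarith
  have hΓs := Real.Gamma_pos_of_pos hs1
  have hΓa := Real.Gamma_pos_of_pos ha
  have inner : ∀ y₁ ∈ Ioi (0 : ℝ), ∀ y₂ ∈ Ioi (0 : ℝ),
      ∫⁻ τ in Ioi (0 : ℝ), ENNReal.ofReal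
        (octantDensity m s (τ, y₁, y₂) * Real.exp (-limitPhase (τ, y₁, y₂))) =
      ∫⁻ w in Ioi (0 : ℝ), ENNReal.ofReal (w ^ s) *
        (ENNReal.ofReal (y₁ ^ (m + s + 1 - 1) * Real.exp (-((1 + w) * y₁))) *
          ENNReal.ofReal (y₂ ^ (m + s + 1 - 1) * Real.exp (-((1 + w) * y₂)))) := by
    intro y₁ h₁ y₂ h₂
    have h₁ : 0 < y₁ := h₁
    have h₂ : 0 < y₂ := h₂
    have e1 : ∀ τ : ℝ, octantDensity m s (τ, y₁, y₂) * Real.exp (-limitPhase (τ, y₁, y₂)) =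
        (y₁ ^ (m - 1) * y₂ ^ (m - 1) * Real.exp (-(y₁ + y₂))) *
          (τ ^ (s + 1 - 1) * Real.exp (-((y₁⁻¹ + y₂⁻¹) * τ))) := by
      intro τ
      simp only [octantDensity, limitPhase]
      rw [show -(y₁ + y₂ + τ / y₁ + τ / y₂) = -(y₁ + y₂) + -((y₁⁻¹ + y₂⁻¹) * τ) by ring,
        Real.exp_add, add_sub_cancel_right]
      ring
    have e2 : ∀ w ∈ Ioi (0 : ℝ), ENNReal.ofReal (w ^ s) *
        (ENNReal.ofReal (y₁ ^ (m + s + 1 - 1) * Real.exp (-((1 + w) * y₁))) *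
          ENNReal.ofReal (y₂ ^ (m + s + 1 - 1) * Real.exp (-((1 + w) * y₂)))) =
        ENNReal.ofReal (y₁ ^ (m + s) * y₂ ^ (m + s) * Real.exp (-(y₁ + y₂))) *
          ENNReal.ofReal (w ^ (s + 1 - 1) * Real.exp (-((y₁ + y₂) * w))) := by
      intro w hw
      have hw : 0 < w := hw
      rw [← ENNReal.ofReal_mul (by positivity), ← ENNReal.ofReal_mul (by positivity),
        ← ENNReal.ofReal_mul (by positivity)]
      congr 1
      have : Real.exp (-((1 + w) * y₁)) * Real.exp (-((1 + w) * y₂)) =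
          Real.exp (-(y₁ + y₂)) * Real.exp (-((y₁ + y₂) * w)) := by
        rw [← Real.exp_add, ← Real.exp_add]; ring_nf
      rw [add_sub_cancel_right, add_sub_cancel_right]
      linear_combination (w ^ s * y₁ ^ (m + s) * y₂ ^ (m + s)) * this
    rw [setLIntegral_congr_fun measurableSet_Ioi e2,
      lintegral_const_mul' _ _ ENNReal.ofReal_ne_top,
      lintegral_rpow_mul_exp_neg_mul_Ioi hs1 (by positivity)]
    simp only [e1]
    have h0 : 0 ≤ y₁ ^ (m - 1) * y₂ ^ (m - 1) * Real.exp (-(y₁ + y₂)) := by positivity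
    simp only [ENNReal.ofReal_mul h0]
    rw [lintegral_const_mul' _ _ ENNReal.ofReal_ne_top,
      lintegral_rpow_mul_exp_neg_mul_Ioi hs1 (by positivity), ← ENNReal.ofReal_mul h0,
      ← ENNReal.ofReal_mul (by positivity)]
    congr 1
    have e3 : 1 / (y₁⁻¹ + y₂⁻¹) = y₁ * (y₂ * (1 / (y₁ + y₂))) := by
      field_simp
      ring
    have e4 : ∀ {y : ℝ}, 0 < y → y ^ (m + s) = y ^ (m - 1) * y ^ (s + 1) := fun hy => by
      rw [← Real.rpow_add hy]
      ring_nf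
    rw [e3, Real.mul_rpow h₁.le (by positivity), Real.mul_rpow h₂.le (by positivity),
      e4 h₁, e4 h₂]
    ring
  have key : ∫⁻ x in posOctant, ENNReal.ofReal
      (octantDensity m s x * Real.exp (-limitPhase x)) =
      ENNReal.ofReal (Real.Gamma (2 * m + s + 1) * Real.Gamma (m + s + 1) ^ 2 *
        Real.Gamma (s + 1) / Real.Gamma (2 * m + 2 * s + 2)) := by
    have hmeas : Measurable fun x => ENNReal.ofReal
        (octantDensity m s x * Real.exp (-limitPhase x)) :=
      ((measurable_octantDensity m s).mul measurable_limitPhase.neg.exp).ennreal_ofReal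
    rw [posOctant, Measure.volume_eq_prod, Measure.volume_eq_prod, ← Measure.prod_restrict,
      lintegral_prod_symm _ hmeas.aemeasurable]
    calc _ = ∫⁻ (y : ℝ × ℝ) in Ioi (0 : ℝ) ×ˢ Ioi (0 : ℝ), (∫⁻ w in Ioi (0 : ℝ), ENNReal.ofReal (w ^ s) *
          (ENNReal.ofReal (y.1 ^ (m + s + 1 - 1) * Real.exp (-((1 + w) * y.1))) *
          ENNReal.ofReal (y.2 ^ (m + s + 1 - 1) * Real.exp (-((1 + w) * y.2)))))
          ∂(volume.prod volume) :=
          setLIntegral_congr_fun (measurableSet_Ioi.prod measurableSet_Ioi)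
            fun y hy => inner y.1 hy.1 y.2 hy.2
      _ = ∫⁻ w in Ioi (0 : ℝ), ∫⁻ (y : ℝ × ℝ) in Ioi (0 : ℝ) ×ˢ Ioi (0 : ℝ), ENNReal.ofReal (w ^ s) *
          (ENNReal.ofReal (y.1 ^ (m + s + 1 - 1) * Real.exp (-((1 + w) * y.1))) *
          ENNReal.ofReal (y.2 ^ (m + s + 1 - 1) * Real.exp (-((1 + w) * y.2))))
          ∂(volume.prod volume) := by
          rw [lintegral_lintegral_swap]
          exact Measurable.aemeasurable (by unfold Function.uncurry; fun_prop)
      _ = ∫⁻ w in Ioi (0 : ℝ), ENNReal.ofReal (Real.Gamma (m + s + 1) ^ 2) *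
          ENNReal.ofReal (w ^ (s + 1 - 1) * (1 + w) ^ (-(s + 1 + (2 * m + s + 1)))) := by
          refine setLIntegral_congr_fun measurableSet_Ioi fun w hw => ?_
          have hw : 0 < w := hw
          rw [lintegral_const_mul' _ _ ENNReal.ofReal_ne_top, ← Measure.prod_restrict,
            lintegral_prod_mul
              (f := fun y => ENNReal.ofReal (y ^ (m + s + 1 - 1) * Real.exp (-((1 + w) * y))))
              (g := fun y => ENNReal.ofReal (y ^ (m + s + 1 - 1) * Real.exp (-((1 + w) * y))))
              (Measurable.aemeasurable (by fun_prop))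
              (Measurable.aemeasurable (by fun_prop)),
            lintegral_rpow_mul_exp_neg_mul_Ioi ha (by positivity),
            ← ENNReal.ofReal_mul (by positivity), ← ENNReal.ofReal_mul (by positivity),
            ← ENNReal.ofReal_mul (by positivity)]
          congr 1
          have h1w : 0 < 1 + w := by linarith
          rw [show -(s + 1 + (2 * m + s + 1)) = -(m + s + 1) + -(m + s + 1) by ring,
            Real.rpow_add h1w, Real.rpow_neg (by positivity), one_div,
            Real.inv_rpow (by positivity), add_sub_cancel_right]
          ring
      _ = _ := by
          rw [lintegral_const_mul' _ _ ENNReal.ofReal_ne_top,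
            lintegral_rpow_mul_one_add_rpow hs1 (by linarith),
            ← ENNReal.ofReal_mul (by positivity)]
          congr 1
          rw [show s + 1 + (2 * m + s + 1) = 2 * m + 2 * s + 2 by ring]
          ring
  have h1 := Real.Gamma_pos_of_pos (show 0 < 2 * m + s + 1 by linarith)
  have h2 := Real.Gamma_pos_of_pos (show 0 < 2 * m + 2 * s + 2 by linarith)
  rw [leadingIntegral, integral_eq_lintegral_of_nonneg_ae, key,
    ENNReal.toReal_ofReal (by positivity)]
  · filter_upwards [ae_restrict_mem measurableSet_posOctant] with x hx
    obtain ⟨h1, h2, h3, h4, h5⟩ := limitPhase_terms_nonneg hx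
    simp only [octantDensity, Pi.zero_apply]
    positivity
  · exact ((measurable_octantDensity m s).mul measurable_limitPhase.neg.exp).aestronglyMeasurable

/-! ### Exact reduction of the coefficient to the octant integral. -/

/-- As `n` is an integer, the Gamma quotient in front of Euler's integral becomes, at `Q = q/ε`, an
exact polynomial in `ε`, so Stirling's formula is not needed. -/
theorem Gamma_add_nat_div_mul_pow (n : ℕ) {Q : ℝ} (hQ : 0 < Q) :
    Real.Gamma (n + Q) / Real.Gamma Q * Q⁻¹ ^ n = ∏ k ∈ Finset.range n, (1 + k / Q) := by
  have hG := Real.Gamma_pos_of_pos hQ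
  induction n with
  | zero => simp [hG.ne']
  | succ n ih =>
    rw [Finset.prod_range_succ, ← ih, Nat.cast_succ, show (n : ℝ) + 1 + Q = n + Q + 1 by ring,
      Real.Gamma_add_one (by positivity), pow_succ]
    field_simp
    ring

/-- Rescaling `w = ε y / q` in Euler's integral. -/
theorem integral_eulerKernel {m p q ε τ : ℝ} (hp : 0 < p) (hq : 0 < q) (hε : 0 < ε) :
    ∫ w in Ioi (0 : ℝ), w ^ (m - 1) * (1 + w) ^ (-(q / ε + m)) *
        (1 + ε ^ 2 / (p * q) * τ / w) ^ (-(p / ε)) =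
      (ε / q) ^ m * ∫ y in Ioi (0 : ℝ), y ^ (m - 1) * eulerKernel m p q ε τ y := by
  have hb : 0 < ε / q := by positivity
  have h := integral_comp_mul_left_Ioi (fun w : ℝ => w ^ (m - 1) * (1 + w) ^ (-(q / ε + m)) *
        (1 + ε ^ 2 / (p * q) * τ / w) ^ (-(p / ε))) 0 hb
  rw [mul_zero, smul_eq_mul, eq_inv_mul_iff_mul_eq₀ hb.ne'] at h
  rw [← h, ← integral_const_mul, ← integral_const_mul]
  refine setIntegral_congr_fun measurableSet_Ioi fun y hy => ?_
  have hy : 0 < y := hy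
  have e1 : ε ^ 2 / (p * q) * τ / (ε / q * y) = ε * (τ / y / p) := by
    field_simp
  have e2 : ε / q * y = ε * (y / q) := by ring
  have e3 : (ε / q) ^ m = ε / q * (ε / q) ^ (m - 1) := by
    rw [Real.rpow_sub_one hb.ne']
    field_simp
  simp only [eulerKernel]
  rw [e1, Real.mul_rpow hb.le hy.le, e2, e3]
  ring

theorem integral_octant_eq (n : ℕ) (s p q ε : ℝ)
    (hint : IntegrableOn (fun x => octantDensity n s x * rescaledIntegrand n p q ε x) posOctant) :
    ∫ x in posOctant, octantDensity n s x * rescaledIntegrand n p q ε x =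
      ∫ τ in Ioi (0 : ℝ), τ ^ s * rescaledPower n p q ε τ *
        ((∏ k ∈ Finset.range n, (1 + ε * ((k : ℝ) / q))) *
          ∫ y in Ioi (0 : ℝ), y ^ ((n : ℝ) - 1) * eulerKernel n p q ε τ y) ^ 2 := by
  rw [posOctant, Measure.volume_eq_prod, Measure.volume_eq_prod] at *
  rw [setIntegral_prod _ hint]
  refine setIntegral_congr_fun measurableSet_Ioi fun τ _ => ?_
  have e : ∀ y : ℝ × ℝ, octantDensity n s (τ, y) * rescaledIntegrand n p q ε (τ, y) =
      (τ ^ s * rescaledPower n p q ε τ * (∏ k ∈ Finset.range n, (1 + ε * ((k : ℝ) / q))) ^ 2) *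
      ((y.1 ^ ((n : ℝ) - 1) * eulerKernel n p q ε τ y.1) *
        (y.2 ^ ((n : ℝ) - 1) * eulerKernel n p q ε τ y.2)) := by
    intro y
    simp only [octantDensity, rescaledIntegrand]
    ring
  simp only [e]
  rw [integral_const_mul, setIntegral_prod_mul (fun y : ℝ => y ^ ((n : ℝ) - 1) *
    eulerKernel n p q ε τ y) (fun y : ℝ => y ^ ((n : ℝ) - 1) * eulerKernel n p q ε τ y)]
  ring

theorem weightedCoeff_eq_integral_octant {n : ℕ} (hn : 1 ≤ n) {s p q ε : ℝ} (hp : 0 < p)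
    (hq : 0 < q) (hε : 0 < ε)
    (hint : IntegrableOn (fun x => octantDensity n s x * rescaledIntegrand n p q ε x) posOctant) :
    weightedCoeff n s (p / ε) (q / ε) = 1 / 2 * (1 / Real.Gamma n ^ 2) *
      (ε ^ 2 / (p * q)) ^ (s + 1) *
        ∫ x in posOctant, octantDensity n s x * rescaledIntegrand n p q ε x := by
  have hn0 : (0 : ℝ) < n := by exact_mod_cast hn
  have hn1 : (1 : ℝ) ≤ n := by exact_mod_cast hn
  have hP : 0 < p / ε := by positivity
  have hQ : 0 < q / ε := by positivity
  have hκ : 0 < ε ^ 2 / (p * q) := by positivity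
  set κ := ε ^ 2 / (p * q) with hκdef
  set J : ℝ → ℝ := fun τ => (∏ k ∈ Finset.range n, (1 + ε * ((k : ℝ) / q))) *
    ∫ y in Ioi (0 : ℝ), y ^ ((n : ℝ) - 1) * eulerKernel n p q ε τ y with hJ
  have hF : ∀ τ : ℝ, 0 < κ * τ → κ * τ < 1 →
      Real.Gamma (n + p / ε) * Real.Gamma (n + q / ε) /
        (Real.Gamma n * Real.Gamma (n + p / ε + q / ε)) *
        ordinaryHypergeometric (p / ε) (q / ε) (p / ε + q / ε + n) (1 - κ * τ) =
      (Real.Gamma n)⁻¹ * J τ := by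
    intro τ h0 h1
    rw [ordinaryHypergeometric_eq_integral hP hQ hn0 h0 h1, hκdef, integral_eulerKernel hp hq hε]
    have := Gamma_add_nat_div_mul_pow n hQ
    have e : ∀ k : ℕ, (k : ℝ) / (q / ε) = ε * ((k : ℝ) / q) := fun k => by field_simp
    simp only [e] at this
    simp only [hJ]
    rw [← this, Real.rpow_natCast, inv_div]
    field_simp
  set Φ : ℝ → ℝ := fun σ => (max (1 - σ) 0) ^ (p / ε + q / ε + n - 1) *
    (J (σ / κ)) ^ 2 * σ ^ s with hΦ
  -- The cutoff makes the integrand vanish for `σ ≥ 1`, since the exponent is positive; the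
  -- rescaling `σ = κ τ` can then be done on the whole half line.
  have hΦ0 : ∫ σ in Ioi (0 : ℝ), Φ σ = ∫ σ in Ioo (0 : ℝ) 1, Φ σ := by
    refine setIntegral_eq_of_subset_of_forall_sdiff_eq_zero measurableSet_Ioi
      Ioo_subset_Ioi_self fun σ hσ => ?_
    have h1 : 1 ≤ σ := not_lt.1 fun h => hσ.2 ⟨hσ.1, h⟩
    simp only [hΦ]
    rw [max_eq_right (by linarith), Real.zero_rpow (by linarith)]
    ring
  have hscale : ∫ σ in Ioi (0 : ℝ), Φ σ = κ * ∫ τ in Ioi (0 : ℝ), Φ (κ * τ) := by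
    have := integral_comp_mul_left_Ioi Φ 0 hκ
    rw [mul_zero, smul_eq_mul, eq_inv_mul_iff_mul_eq₀ hκ.ne'] at this
    exact this.symm
  have hoct : κ * ∫ τ in Ioi (0 : ℝ), Φ (κ * τ) = κ ^ (s + 1) *
      ∫ x in posOctant, octantDensity n s x * rescaledIntegrand n p q ε x := by
    rw [integral_octant_eq n s p q ε hint, ← integral_const_mul, ← integral_const_mul]
    refine setIntegral_congr_fun measurableSet_Ioi fun τ hτ => ?_
    have hτ : 0 < τ := hτ
    simp only [hΦ]
    rw [Real.mul_rpow hκ.le hτ.le, Real.rpow_add_one hκ.ne', mul_div_cancel_left₀ _ hκ.ne',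
      rescaledPower, show ε * (ε * τ / (p * q)) = κ * τ by rw [hκdef]; ring]
    ring
  have hcoeff : ∫ t in (0 : ℝ)..1, t ^ (p / ε + q / ε + n - 1) *
      (Real.Gamma (n + p / ε) * Real.Gamma (n + q / ε) /
        (Real.Gamma n * Real.Gamma (n + p / ε + q / ε)) *
        ordinaryHypergeometric (p / ε) (q / ε) (p / ε + q / ε + n) t) ^ 2 * (1 - t) ^ s =
      (1 / Real.Gamma n ^ 2) * ∫ σ in Ioo (0 : ℝ) 1, Φ σ := by
    have h := intervalIntegral.integral_comp_sub_left (a := 0) (b := 1)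
      (fun t : ℝ => t ^ (p / ε + q / ε + n - 1) *
      (Real.Gamma (n + p / ε) * Real.Gamma (n + q / ε) /
        (Real.Gamma n * Real.Gamma (n + p / ε + q / ε)) *
        ordinaryHypergeometric (p / ε) (q / ε) (p / ε + q / ε + n) t) ^ 2 * (1 - t) ^ s) 1
    rw [sub_self, sub_zero] at h
    rw [← h, intervalIntegral.integral_of_le zero_le_one, integral_Ioc_eq_integral_Ioo,
      ← integral_const_mul]
    refine setIntegral_congr_fun measurableSet_Ioo fun σ hσ => ?_
    have h1 := hF (σ / κ)
    rw [mul_div_cancel₀ _ hκ.ne'] at h1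
    simp only [hΦ]
    rw [h1 hσ.1 hσ.2, max_eq_left (by linarith [hσ.2]), sub_sub_cancel]
    ring
  rw [mul_assoc (1 / 2 * (1 / Real.Gamma n ^ 2)), ← hoct, ← hscale, hΦ0, mul_assoc (1 / 2),
    ← hcoeff, weightedCoeff, mul_assoc (1 / 2), ← intervalIntegral.integral_const_mul]
  congr 2
  ext t
  ring

theorem theorem5p1 (n : ℕ) (hn : 1 ≤ n) (s : ℝ) (hs : -1 < s) :
    ∃ a : ℕ → ℝ → ℝ → ℝ, ∀ p q : ℝ, 0 < p → 0 < q →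
      a 0 p q = 1 ∧
      ∀ N : ℕ,
        (fun x : ℝ => weightedCoeff n s (x * p) (x * q) -
          1 / 2 * (Real.Gamma (2 * n + s + 1) * Real.Gamma (n + s + 1) ^ 2 * Real.Gamma (s + 1)
              / (Real.Gamma n ^ 2 * Real.Gamma (2 * n + 2 * s + 2))) *
            (x ^ (-2 * s - 2) * (p * q) ^ (-s - 1)) *
            ∑ j ∈ Finset.range N, a j p q / x ^ j)
          =O[atTop] fun x : ℝ => x ^ (-2 * s - 2 - (N : ℝ)) := by
  have hn0 : (0 : ℝ) < n := by exact_mod_cast hn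
  have hΓn := Real.Gamma_pos_of_pos hn0
  set L := leadingIntegral n s with hL
  have hLeq := leadingIntegral_eq hn0 hs
  have hL0 : 0 < L := by
    rw [hL, hLeq]
    have h1 := Real.Gamma_pos_of_pos (show 0 < 2 * (n : ℝ) + s + 1 by linarith)
    have h2 := Real.Gamma_pos_of_pos (show 0 < 2 * (n : ℝ) + 2 * s + 2 by linarith)
    have h3 := Real.Gamma_pos_of_pos (show 0 < (n : ℝ) + s + 1 by linarith)
    have h4 := Real.Gamma_pos_of_pos (show 0 < s + 1 by linarith)
    positivity
  -- Positivity is moved inside the existential so that `choose` yields functions of all real `p,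
  -- q`; the sequence `0` is a filler elsewhere.
  have hex : ∀ p q : ℝ, ∃ c : ℕ → ℝ, 0 < p → 0 < q → c 0 = L ∧ ∀ N : ℕ,
      (fun ε => (∫ x in posOctant, octantDensity n s x * rescaledIntegrand n p q ε x) -
        ∑ j ∈ Finset.range N, c j * ε ^ j) =O[𝓝[>] (0 : ℝ)] fun ε => ε ^ N := by
    intro p q
    by_cases h : 0 < p ∧ 0 < q
    · obtain ⟨c, hc⟩ := exists_coeff_rescaledIntegrand hn hs h.1 h.2
      exact ⟨c, fun _ _ => hc⟩
    · exact ⟨0, fun hp hq => absurd ⟨hp, hq⟩ h⟩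
  choose c hc using hex
  refine ⟨fun j p q => c p q j / L, fun p q hp hq => ⟨?_, fun N => ?_⟩⟩
  · simp only [(hc p q hp hq).1]
    exact div_self hL0.ne'
  -- Substitution `ε = x⁻¹`.
  have hO := ((hc p q hp hq).2 N).comp_tendsto tendsto_inv_atTop_nhdsGT_zero
  obtain ⟨K, hK⟩ := integrableOn_octantDensity n s hn0 hs
  obtain ⟨C, hC⟩ := rescaledIntegrand_decay hn hp hq K
  have hmul := (isBigO_refl (fun x : ℝ => x ^ (-2 * s - 2)) atTop).mul hO
  refine (hmul.const_mul_left (1 / 2 * (1 / Real.Gamma n ^ 2) * (p * q) ^ (-s - 1))).congr' ?_ ?_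
  · filter_upwards [eventually_gt_atTop 0, tendsto_inv_atTop_nhdsGT_zero.eventually hC]
      with x hx hCx
    have hε : 0 < x⁻¹ := inv_pos.2 hx
    have hW := weightedCoeff_eq_integral_octant hn (s := s) hp hq hε
      (integrable_mul_of_le_growthWeight measurableSet_posOctant hK
        (measurable_octantDensity n s) (measurable_rescaledIntegrand n p q x⁻¹) hCx)
    rw [div_inv_eq_mul, div_inv_eq_mul, mul_comm p x, mul_comm q x] at hW
    have hpow : ((x⁻¹) ^ 2 / (p * q)) ^ (s + 1) = x ^ (-2 * s - 2) * (p * q) ^ (-s - 1) := by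
      rw [Real.div_rpow (by positivity) (by positivity), ← Real.rpow_natCast, ← Real.rpow_mul hε.le,
        Real.inv_rpow hx.le, ← Real.rpow_neg hx.le, div_eq_mul_inv,
        ← Real.rpow_neg (by positivity)]
      push_cast
      ring_nf
    have hconst : Real.Gamma (2 * n + s + 1) * Real.Gamma (n + s + 1) ^ 2 * Real.Gamma (s + 1)
        / (Real.Gamma n ^ 2 * Real.Gamma (2 * n + 2 * s + 2)) = 1 / Real.Gamma n ^ 2 * L := by
      rw [hL, hLeq]
      ring
    have hsum : ∑ j ∈ Finset.range N, c p q j / L / x ^ j =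
        L⁻¹ * ∑ j ∈ Finset.range N, c p q j * (x⁻¹) ^ j := by
      rw [Finset.mul_sum]
      refine Finset.sum_congr rfl fun j _ => ?_
      rw [inv_pow]
      ring
    rw [hW, hpow, hconst, hsum]
    simp only [Function.comp_apply]
    field_simp
  · filter_upwards [eventually_gt_atTop 0] with x hx
    simp only [Function.comp_apply]
    rw [Real.rpow_sub hx _ (N : ℝ), Real.rpow_natCast, inv_pow, div_eq_mul_inv]
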